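/- Non-trivial zeros of the Riemann zeta function $\zeta$ are its zeros in the strip $0<\operatorname{Re}s<1$. Let $N(T)$ be the number of non-trivial zeros with imaginary part in $[0,T]$, counted with multiplicity, and let $\gamma$ run over the set of distinct positive imaginary parts (ordinates) of the non-trivial zeros. Assume the Effective Linear Independence conjecture: for every $\varepsilon>0$ there is a constant $C_\varepsilon>0$ such that for all real $T\ge 2$ and all integers $(\ell_\gamma)_{0<\gamma\le T}$, not all zero, with $|\ell_\gamma|\le N(T)$, one has $$\Big|\sum_{0<\gamma\le T}\ell_\gamma\gamma\Big|\ge C_\varepsilon e^{-T^{1+\varepsilon}}.$$ Let $\{r_\gamma\}_{\gamma>0}$ be a family of complex numbers indexed by the ordinates and let $A>0$ be such that $$\sum_{0<\gamma\le T}|r_\gamma|\asymp(\log T)^A\qquad (T\to\infty).$$ Put $\beta_\gamma=\arg r_\gamma$ and $F(t,T)=\sum_{0<\gamma\le T}|r_\gamma|\cos(\gamma t+\beta_\gamma)$. Let $\varepsilon>0$ be fixed. Then there exist constants $c_0>0$, $C>0$ and $X_0$, depending only on $\{r_\gamma\}$, $A$ and $\varepsilon$, such that for every family $\{\theta_\gamma\}_{\gamma>0}$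 of independent random variables uniformly distributed on $[-\pi,\pi]$, all $X\ge X_0$, all real $T$ with $2\le T\le(\log X)^{1-\varepsilon}$, and all real $s$ with $|s|\le c_0T(\log T)^{1-A}$, $$\left|\frac1X\int_2^X\exp\big(sF(t,T)\big)\,dt-\mathbb E\left(\exp\Big(s\sum_{0<\gamma\le T}|r_\gamma|\cos\theta_\gamma\Big)\right)\right|\le C\,e^{-N(T)}.$$ -/

import Mathlib

open MeasureTheory ProbabilityTheory Filter Asymptotics

/-- The non-trivial zeros `ρ` of the Riemann zeta function: the zeros in the open critical strip. -/
def zetaZeros : Set ℂ := {ρ | riemannZeta ρ = 0 ∧ 0 < ρ.re ∧ ρ.re < 1}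

/-- There are finitely many non-trivial zeros with imaginary part in `[0, T]`. -/
theorem zetaZeros_finite (T : ℝ) : {ρ ∈ zetaZeros | 0 ≤ ρ.im ∧ ρ.im ≤ T}.Finite := by
  by_contra hinf
  have hK : IsCompact (Set.Icc (0 : ℝ) 1 ×ℂ Set.Icc (0 : ℝ) T) :=
    isCompact_Icc.reProdIm isCompact_Icc
  have hsub : {ρ ∈ zetaZeros | 0 ≤ ρ.im ∧ ρ.im ≤ T} ⊆ Set.Icc (0 : ℝ) 1 ×ℂ Set.Icc (0 : ℝ) T := by
    rintro ρ ⟨⟨-, h0, h1⟩, h2, h3⟩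
    exact ⟨⟨h0.le, h1.le⟩, h2, h3⟩
  obtain ⟨z, -, hz⟩ := Set.Infinite.exists_accPt_of_subset_isCompact hinf hK hsub
  have hfreq : ∃ᶠ w in nhdsWithin z {z}ᶜ, riemannZeta₁ w = 0 := by
    refine (accPt_iff_frequently_nhdsNE.1 hz).mono ?_
    rintro w ⟨⟨hw, -, h1⟩, -⟩
    have hw1 : w ≠ 1 := by
      rintro rfl
      simp at h1
    have := riemannZeta_eq_inv_sub_mul hw1
    rw [hw] at this
    rcases mul_eq_zero.1 this.symm with h | h
    · exact absurd (inv_eq_zero.1 h) (sub_ne_zero.2 hw1)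
    · exact h
  have han : AnalyticOnNhd ℂ riemannZeta₁ Set.univ := fun w _ =>
    differentiable_riemannZeta₁.analyticAt w
  have h := han.eqOn_zero_of_preconnected_of_frequently_eq_zero isPreconnected_univ
    (Set.mem_univ z) hfreq (Set.mem_univ 1)
  simp at h

/-- `N(T)`: the number of non-trivial zeros of zeta with imaginary part in `[0, T]`, counted with
multiplicity. -/
noncomputable def zeroCount (T : ℝ) : ℕ :=
  ∑ ρ ∈ (zetaZeros_finite T).toFinset, analyticOrderNatAt riemannZeta ρ

/-- The set of positive ordinates `γ` of the non-trivial zeros of zeta. -/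
def zetaOrdinates : Set ℝ := {γ | 0 < γ ∧ ∃ ρ ∈ zetaZeros, ρ.im = γ}

theorem zetaOrdinates_finite (T : ℝ) : {γ : zetaOrdinates | (γ : ℝ) ≤ T}.Finite := by
  refine Set.Finite.of_finite_image (f := Subtype.val)
    (((zetaZeros_finite T).image Complex.im).subset ?_) Subtype.val_injective.injOn
  rintro _ ⟨⟨γ, hγ, ρ, hρ, rfl⟩, h, rfl⟩
  exact ⟨ρ, ⟨hρ, hγ.le, h⟩, rfl⟩

/-- The finite set of ordinates `0 < γ ≤ T`. -/
noncomputable def ordinatesUpTo (T : ℝ) : Finset zetaOrdinates :=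
  (zetaOrdinates_finite T).toFinset

/-- The Effective Linear Independence conjecture. -/
def EffectiveLI : Prop :=
  ∀ ε : ℝ, 0 < ε → ∃ C : ℝ, 0 < C ∧ ∀ T : ℝ, 2 ≤ T → ∀ l : zetaOrdinates → ℤ,
    (∀ γ ∈ ordinatesUpTo T, |l γ| ≤ (zeroCount T : ℤ)) →
    (∃ γ ∈ ordinatesUpTo T, l γ ≠ 0) →
    C * Real.exp (-(T ^ (1 + ε))) ≤ |∑ γ ∈ ordinatesUpTo T, (l γ : ℝ) * (γ : ℝ)|

/-- Assumption 1 on the coefficients, with its positive exponent `A`: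
`H(T) = ∑_{0 < γ ≤ T} |r_γ| ≍ (log T)^A`. -/
def Assumption1 (r : zetaOrdinates → ℂ) (A : ℝ) : Prop :=
  0 < A ∧ (fun T : ℝ => ∑ γ ∈ ordinatesUpTo T, ‖r γ‖) =Θ[atTop] fun T : ℝ => Real.log T ^ A

/-- `F(t, T) = ∑_{0 < γ ≤ T} |r_γ| cos(γ t + arg r_γ)`. -/
noncomputable def zeroSum (r : zetaOrdinates → ℂ) (t T : ℝ) : ℝ :=
  ∑ γ ∈ ordinatesUpTo T, Real.cos (γ * t + (r γ).arg) * ‖r γ‖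

/-- The family `θ` consists of independent random variables, each uniformly distributed on
`[-π, π]`. -/
structure IsUniformIIDFamily {ι Ω : Type*} [MeasurableSpace Ω] (μ : Measure Ω)
    (θ : ι → Ω → ℝ) : Prop where
  measurable : ∀ i, Measurable (θ i)
  indep : iIndepFun θ μ
  uniform : ∀ i, pdf.IsUniform (θ i) (Set.Icc (-Real.pi) Real.pi) μ volume

/-! ### Size of ζ on vertical lines, from the functional equation and the Dirichlet series. -/

section ZetaGrowth

open Complex Set Topology

/-! Expand exp(sF) in its Taylor series. Each power F^k is a trigonometric polynomial whose
frequencies are integer combinations ∑ ℓ_γ γ with |ℓ_γ| ≤ k. Terms with ℓ = 0 contribute to the time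
average exactly as to the random model, up to 2/X. For ℓ ≠ 0 the expectation vanishes and the time
average is O(1/(X|∑ ℓ_γ γ|)), which Effective LI controls (`abs_average_pow_sub_integral_pow_le`,
`abs_average_exp_sub_integral_exp_le`).

With Y = |s| ∑ |r_γ| ≪ T log T, truncating at order k ≥ N(T) + 3Y leaves a tail of size e^{-N(T)}.
Such a k may exceed N(T), the coefficient bound at height T. So the conjecture is applied at height
T' = T^{1+η}, with zero coefficients beyond T: N(T') ≫ T' exceeds k, and the loss exp(T^{(1+η)^2})
is still beaten by X ≥ exp(T^{1+ε}). Hence no smallness of s is needed beyond |s| ≤ T (log T)^{1-A}.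
Bounded T is trivial.

Only N(T) ≪ T log T and N(T) ≫ T are used. The upper bound is Jensen's formula with polynomial
growth of (s-1)ζ(s), obtained by Phragmén–Lindelöf. For the lower bound, a gap in the zeros around
height T would make log|ζ| a small multiple of log T between abscissas -1/2 and 3/2, whereas the
functional equation forces |ζ(-1/2+iT)| ≍ T |ζ(3/2+iT)|. -/

theorem norm_Gamma_le_Gamma_re {s : ℂ} (hs : 0 < s.re) : ‖Gamma s‖ ≤ Real.Gamma s.re := by
  rw [Gamma_eq_integral hs, GammaIntegral, Real.Gamma_eq_integral hs]
  refine (norm_integral_le_integral_norm _).trans_eq ?_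
  refine setIntegral_congr_fun measurableSet_Ioi fun x hx => ?_
  have hx : 0 < x := hx
  simp only [norm_mul, norm_real, Real.norm_eq_abs, abs_of_pos (Real.exp_pos _)]
  rw [norm_cpow_eq_rpow_re_of_pos hx]
  simp

/-- On the line Re s = 1/2 the reflection s ↦ 1 - s is complex conjugation, so the reflection
formula computes |Γ|² exactly. -/
theorem norm_Gamma_half_add_mul_I_sq (t : ℝ) :
    ‖Gamma (1 / 2 + t * I)‖ ^ 2 = Real.pi / Real.cosh (Real.pi * t) := by
  have hconj : (starRingEnd ℂ) (1 / 2 + t * I) = 1 - (1 / 2 + t * I) := by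
    apply Complex.ext <;> norm_num
  have h := Complex.Gamma_mul_Gamma_one_sub (1 / 2 + t * I)
  rw [← hconj, Gamma_conj, mul_conj, normSq_eq_norm_sq] at h
  have hsin : sin (Real.pi * (1 / 2 + t * I)) = (Real.cosh (Real.pi * t) : ℝ) := by
    rw [show (Real.pi : ℂ) * (1 / 2 + t * I) = (Real.pi * t : ℝ) * I + Real.pi / 2 by
      push_cast; ring, sin_add_pi_div_two, cos_mul_I, ofReal_cosh]
  rw [hsin] at h
  exact_mod_cast h

theorem norm_cos_add_mul_I_sq {a : ℝ} (ha : Real.cos a ^ 2 = 1 / 2) (b : ℝ) :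
    ‖cos (a + b * I)‖ ^ 2 = Real.cosh (2 * b) / 2 := by
  have hs : Real.sin a ^ 2 = 1 / 2 := by linarith [Real.sin_sq_add_cos_sq a]
  rw [cos_add_mul_I, Complex.sq_norm, normSq_apply, ← ofReal_cos, ← ofReal_sin, ← ofReal_cosh,
    ← ofReal_sinh, Real.cosh_two_mul]
  simp only [sub_re, mul_re, ofReal_re, ofReal_im, I_re, I_im, sub_im, mul_im]
  ring_nf
  rw [ha, hs]
  ring

/-- The two hyperbolic cosines cancel exactly. On the lines used below, this reduces the gamma
factor of the functional equation to linear factors, with no need of Stirling's formula. -/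
theorem norm_Gamma_mul_cos_of_re_eq {a : ℝ} (ha : Real.cos (Real.pi * a / 2) ^ 2 = 1 / 2) (t : ℝ) :
    ‖Gamma (1 / 2 + t * I)‖ * ‖cos (Real.pi * (a + t * I) / 2)‖ = √(Real.pi / 2) := by
  rw [← mul_self_inj (by positivity) (by positivity), ← sq, mul_pow, norm_Gamma_half_add_mul_I_sq,
    show (Real.pi : ℂ) * (a + t * I) / 2 = (Real.pi * a / 2 : ℝ) + (Real.pi * t / 2 : ℝ) * I by
      push_cast; ring, norm_cos_add_mul_I_sq ha, Real.mul_self_sqrt (by positivity),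
    show 2 * (Real.pi * t / 2) = Real.pi * t by ring]
  field_simp [(Real.cosh_pos (Real.pi * t)).ne']

theorem norm_two_mul_two_pi_cpow (s : ℂ) :
    ‖(2 : ℂ) * (2 * Real.pi) ^ (-s)‖ = 2 * (2 * Real.pi) ^ (-s.re) := by
  rw [norm_mul, show (2 * Real.pi : ℂ) = (2 * Real.pi : ℝ) by push_cast; rfl,
    norm_cpow_eq_rpow_re_of_pos (by positivity)]
  simp

/-- The functional equation on the line `Re s = -1/2`, where the gamma factor is elementary. -/
theorem exists_norm_riemannZeta_neg_half :
    ∃ c : ℝ, 0 < c ∧ ∀ t : ℝ,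
      ‖riemannZeta (-1 / 2 - t * I)‖ = c * ‖1 / 2 + t * I‖ * ‖riemannZeta (3 / 2 + t * I)‖ := by
  refine ⟨2 * (2 * Real.pi) ^ (-(3 / 2 : ℝ)) * √(Real.pi / 2), by positivity, fun t => ?_⟩
  have hre : (3 / 2 + t * I : ℂ).re = 3 / 2 := by simp
  have h1 := riemannZeta_one_sub (s := 3 / 2 + t * I)
    (fun n h => by
      have := congrArg re h
      simp at this
      linarith [n.cast_nonneg (α := ℝ)])
    (fun h => by have := congrArg re h; norm_num at this)
  rw [show (1 : ℂ) - (3 / 2 + t * I) = -1 / 2 - t * I by ring] at h1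
  have hcos : Real.cos (Real.pi * (3 / 2) / 2) ^ 2 = 1 / 2 := by
    rw [Real.cos_sq, show 2 * (Real.pi * (3 / 2) / 2) = Real.pi / 2 + Real.pi by ring,
      Real.cos_add_pi]
    simp
  have hG : Gamma (3 / 2 + t * I) = (1 / 2 + t * I) * Gamma (1 / 2 + t * I) := by
    rw [← Gamma_add_one _ (fun h => by have := congrArg re h; norm_num at this)]
    congr 1; ring
  have h2 := norm_Gamma_mul_cos_of_re_eq hcos t
  rw [h1, norm_mul, norm_mul, norm_mul, norm_two_mul_two_pi_cpow, hre, hG, norm_mul, ← h2]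
  push_cast
  ring

/-- Two shifts of Γ from 5/2 to 1/2 produce the two linear factors. This controls the left edge of
the strip in Phragmén–Lindelöf. -/
theorem exists_norm_riemannZeta_neg_three_half :
    ∃ c : ℝ, 0 < c ∧ ∀ t : ℝ, ‖riemannZeta (-3 / 2 - t * I)‖ =
      c * (‖3 / 2 + t * I‖ * ‖1 / 2 + t * I‖) * ‖riemannZeta (5 / 2 + t * I)‖ := by
  refine ⟨2 * (2 * Real.pi) ^ (-(5 / 2 : ℝ)) * √(Real.pi / 2), by positivity, fun t => ?_⟩
  have hre : (5 / 2 + t * I : ℂ).re = 5 / 2 := by simp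
  have h1 := riemannZeta_one_sub (s := 5 / 2 + t * I)
    (fun n h => by
      have := congrArg re h
      simp at this
      linarith [n.cast_nonneg (α := ℝ)])
    (fun h => by have := congrArg re h; norm_num at this)
  rw [show (1 : ℂ) - (5 / 2 + t * I) = -3 / 2 - t * I by ring] at h1
  have hcos : Real.cos (Real.pi * (5 / 2) / 2) ^ 2 = 1 / 2 := by
    rw [Real.cos_sq, show 2 * (Real.pi * (5 / 2) / 2) = Real.pi / 2 + 2 * Real.pi by ring,
      Real.cos_add_two_pi]
    simp
  have hG : Gamma (5 / 2 + t * I) =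
      (3 / 2 + t * I) * ((1 / 2 + t * I) * Gamma (1 / 2 + t * I)) := by
    rw [← Gamma_add_one _ (fun h => by have := congrArg re h; norm_num at this),
      show (1 / 2 + t * I + 1 : ℂ) = 3 / 2 + t * I by ring,
      ← Gamma_add_one _ (fun h => by have := congrArg re h; norm_num at this)]
    congr 1; ring
  have h2 := norm_Gamma_mul_cos_of_re_eq hcos t
  rw [h1, norm_mul, norm_mul, norm_mul, norm_two_mul_two_pi_cpow, hre, hG, norm_mul, norm_mul,
    ← h2]
  push_cast
  ring

theorem summable_one_div_nat_add_one_rpow {σ : ℝ} (hσ : 1 < σ) :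
    Summable fun n : ℕ => 1 / ((n : ℝ) + 1) ^ σ := by
  have := (summable_nat_add_iff 1).2 (Real.summable_one_div_nat_rpow.2 hσ)
  simpa using this

theorem norm_one_div_nat_add_one_cpow (n : ℕ) (s : ℂ) :
    ‖1 / ((n : ℂ) + 1) ^ s‖ = 1 / ((n : ℝ) + 1) ^ s.re := by
  rw [norm_div, norm_one, show ((n : ℂ) + 1) = ((n + 1 : ℝ) : ℂ) by push_cast; rfl,
    norm_cpow_eq_rpow_re_of_pos (by positivity)]

/-- `ζ` is bounded on every closed half-plane to the right of `Re s = 1`. -/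
theorem norm_riemannZeta_le_tsum {σ : ℝ} (hσ : 1 < σ) {s : ℂ} (hs : σ ≤ s.re) :
    ‖riemannZeta s‖ ≤ ∑' n : ℕ, 1 / ((n : ℝ) + 1) ^ σ := by
  rw [zeta_eq_tsum_one_div_nat_add_one_cpow (hσ.trans_le hs)]
  have h1 : ∀ n : ℕ, ‖1 / ((n : ℂ) + 1) ^ s‖ ≤ 1 / ((n : ℝ) + 1) ^ σ := fun n => by
    rw [norm_one_div_nat_add_one_cpow]
    gcongr
    linarith [n.cast_nonneg (α := ℝ)]
  exact tsum_of_norm_bounded (summable_one_div_nat_add_one_rpow hσ).hasSum h1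

/-- `ζ` is bounded away from zero on the line `Re s = 2`. -/
theorem exists_le_norm_riemannZeta_of_re_eq_two :
    ∃ c : ℝ, 0 < c ∧ c ≤ 1 ∧ ∀ s : ℂ, s.re = 2 → c ≤ ‖riemannZeta s‖ := by
  have hS := summable_one_div_nat_add_one_rpow (σ := 2) (by norm_num)
  have hz : HasSum (fun n : ℕ => 1 / ((n : ℝ) + 1) ^ (2 : ℝ)) (Real.pi ^ 2 / 6) := by
    have := (hasSum_nat_add_iff' 1).2 hasSum_zeta_two
    simpa using this
  -- The terms after the first have total modulus at most ζ(2) - 1 < 1, so the leading term 1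
  -- dominates.
  have hpi : Real.pi ^ 2 / 6 < 2 := by nlinarith [Real.pi_lt_d2, Real.pi_gt_three]
  refine ⟨min 1 (2 - Real.pi ^ 2 / 6), lt_min one_pos (by linarith), min_le_left _ _,
    fun s hs => (min_le_right _ _).trans ?_⟩
  have hz' : HasSum (fun n : ℕ => 1 / (((n + 1 : ℕ) : ℝ) + 1) ^ (2 : ℝ)) (Real.pi ^ 2 / 6 - 1) := by
    have := (hasSum_nat_add_iff' 1).2 hz
    simpa using this
  have hzs := zeta_eq_tsum_one_div_nat_add_one_cpow (s := s) (by linarith)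
  have hsum : Summable fun n : ℕ => 1 / ((n : ℂ) + 1) ^ s := by
    refine .of_norm ?_
    simp_rw [norm_one_div_nat_add_one_cpow, hs]
    exact hS
  rw [hsum.tsum_eq_zero_add] at hzs
  have hb : ‖∑' n : ℕ, 1 / (((n + 1 : ℕ) : ℂ) + 1) ^ s‖ ≤ Real.pi ^ 2 / 6 - 1 := by
    refine tsum_of_norm_bounded hz' fun n => ?_
    rw [norm_one_div_nat_add_one_cpow, hs]
  have h1 : (1 : ℂ) / ((0 : ℕ) + 1) ^ s = 1 := by simp
  rw [hzs, h1]
  have := norm_sub_le_norm_add (1 : ℂ) (∑' n : ℕ, 1 / (((n + 1 : ℕ) : ℂ) + 1) ^ s)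
  rw [norm_one] at this
  linarith

end ZetaGrowth

/-! ### Polynomial growth of (s-1)ζ(s) in a strip by Phragmén–Lindelöf. -/

section ZetaStrip

open Complex Set Topology

/-- The kernel t^{Re s - 1} is at most t^{a-1} for t ≤ 1 and at most t^{b-1} for t ≥ 1. -/
theorem norm_mellin_le_of_mem_Icc {f : ℝ → ℂ} {a b : ℝ} (ha : MellinConvergent f a)
    (hb : MellinConvergent f b) {s : ℂ} (h1 : a ≤ s.re) (h2 : s.re ≤ b) :
    ‖mellin f s‖ ≤ (∫ t in Ioi (0 : ℝ), ‖(t : ℂ) ^ ((a : ℂ) - 1) • f t‖) +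
      ∫ t in Ioi (0 : ℝ), ‖(t : ℂ) ^ ((b : ℂ) - 1) • f t‖ := by
  rw [mellin, ← integral_add ha.norm hb.norm]
  refine norm_integral_le_of_norm_le (ha.norm.add hb.norm) ?_
  filter_upwards [ae_restrict_mem measurableSet_Ioi] with t ht
  have ht : 0 < t := ht
  simp only [norm_smul, norm_cpow_eq_rpow_re_of_pos ht, sub_re, ofReal_re, one_re, ← add_mul]
  gcongr
  rcases le_total t 1 with h | h
  · have := Real.rpow_le_rpow_of_exponent_ge ht h (sub_le_sub_right h1 1)
    have := Real.rpow_nonneg ht.le (b - 1)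
    linarith
  · have := Real.rpow_le_rpow_of_exponent_le h (sub_le_sub_right h2 1)
    have := Real.rpow_nonneg ht.le (a - 1)
    linarith

/-- `completedRiemannZeta₀` is, up to scaling, a Mellin transform convergent at every s, hence
bounded on vertical strips. -/
theorem exists_norm_completedRiemannZeta₀_le (a b : ℝ) :
    ∃ M : ℝ, 0 ≤ M ∧ ∀ s : ℂ, a ≤ s.re → s.re ≤ b → ‖completedRiemannZeta₀ s‖ ≤ M := by
  set P := HurwitzZeta.hurwitzEvenFEPair 0
  have hconv : ∀ s : ℂ, MellinConvergent P.f_modif s := fun s =>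
    (P.isStrongFEPair_toStrongFEPair.hasMellin s).1
  refine ⟨(∫ t in Ioi (0 : ℝ), ‖(t : ℂ) ^ (((a / 2 : ℝ) : ℂ) - 1) • P.f_modif t‖) +
      ∫ t in Ioi (0 : ℝ), ‖(t : ℂ) ^ (((b / 2 : ℝ) : ℂ) - 1) • P.f_modif t‖,
    add_nonneg (integral_nonneg fun _ => norm_nonneg _) (integral_nonneg fun _ => norm_nonneg _),
    fun s h1 h2 => ?_⟩
  have hre : (s / 2).re = s.re / 2 := by simp
  have h := norm_mellin_le_of_mem_Icc (hconv (a / 2 : ℝ)) (hconv (b / 2 : ℝ)) (s := s / 2)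
    (by rw [hre]; linarith) (by rw [hre]; linarith)
  have hdef : completedRiemannZeta₀ s = mellin P.f_modif (s / 2) / 2 := rfl
  rw [hdef, norm_div]
  refine le_trans ?_ h
  norm_num

theorem norm_sin_le_exp_abs_im (z : ℂ) : ‖sin z‖ ≤ Real.exp |z.im| := by
  rw [sin, norm_div, norm_mul, norm_I, mul_one]
  have h1 : ‖exp (-z * I)‖ ≤ Real.exp |z.im| := by
    rw [norm_exp]; gcongr; simpa using le_abs_self z.im
  have h2 : ‖exp (z * I)‖ ≤ Real.exp |z.im| := by
    rw [norm_exp]; gcongr; simpa using neg_le_abs z.im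
  have := norm_sub_le (exp (-z * I)) (exp (z * I))
  rw [show ‖(2 : ℂ)‖ = 2 by norm_num]
  linarith

/-- An exponential bound for `1 / Γ` in a vertical strip. -/
theorem exists_norm_inv_Gamma_le :
    ∃ M : ℝ, 0 ≤ M ∧ ∀ w : ℂ, 1 / 4 ≤ w.re → w.re ≤ 9 / 4 → 1 ≤ |w.im| →
      ‖(Gamma w)⁻¹‖ ≤ M * Real.exp (Real.pi * |w.im|) := by
  obtain ⟨M, hM⟩ := isCompact_Icc.exists_bound_of_continuousOn (s := Icc (7 / 4 : ℝ) (15 / 4))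
    (f := Real.Gamma) (fun x hx => (Real.differentiableAt_Gamma fun m h => by
      have h2 := hx.1
      rw [h] at h2
      linarith [m.cast_nonneg (α := ℝ)]).continuousAt.continuousWithinAt)
  have hM0 : 0 ≤ M := (norm_nonneg _).trans (hM 2 ⟨by norm_num, by norm_num⟩)
  refine ⟨M, hM0, fun w h1 h2 h3 => ?_⟩
  have hne : ∀ x : ℂ, x.im = w.im → x ≠ 0 := fun x hx h => by
    rw [h, zero_im] at hx
    rw [← hx] at h3
    norm_num at h3
  have hnorm : ∀ x : ℂ, x.im = w.im → ‖x⁻¹‖ ≤ 1 := fun x hx => by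
    rw [norm_inv]
    exact inv_le_one_of_one_le₀ (h3.trans (hx ▸ abs_im_le_norm x))
  -- After the shift, the reflected point 4 - w has real part in [7/4, 15/4], where Γ is bounded.
  -- The linear factors have modulus at least 1 and only help.
  have e1 : Gamma w = (w - 1) * ((w - 2) * ((w - 3) * Gamma (w - 3))) := by
    rw [← Gamma_add_one _ (hne (w - 3) (by simp)), show w - 3 + 1 = w - 2 by ring,
      ← Gamma_add_one _ (hne (w - 2) (by simp)), show w - 2 + 1 = w - 1 by ring,
      ← Gamma_add_one _ (hne (w - 1) (by simp)), show w - 1 + 1 = w by ring]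
  have hre : (4 - w).re = 4 - w.re := by simp
  have hG4 : Gamma (4 - w) ≠ 0 := Gamma_ne_zero_of_re_pos (by rw [hre]; linarith)
  have e2 : (Gamma (w - 3))⁻¹ = Gamma (4 - w) * sin (Real.pi * (w - 3)) / Real.pi := by
    have h := Gamma_mul_Gamma_one_sub (w - 3)
    rw [show (1 : ℂ) - (w - 3) = 4 - w by ring] at h
    have hsin : sin (Real.pi * (w - 3)) ≠ 0 := by
      rw [sin_ne_zero_iff]
      intro k hk
      have := congrArg im hk
      have h0 : w.im ≠ 0 := fun h => hne w rfl |>.elim (by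
        rw [h] at h3; norm_num at h3)
      simp [mul_im, Real.pi_ne_zero, h0] at this
    rw [inv_eq_iff_eq_inv, inv_div, eq_div_iff (mul_ne_zero hG4 hsin), ← mul_assoc, h,
      div_mul_cancel₀ _ hsin]
  have e3 : ‖(Gamma (w - 3))⁻¹‖ ≤ M * Real.exp (Real.pi * |w.im|) := by
    rw [e2, norm_div, norm_mul, norm_real, Real.norm_eq_abs, abs_of_pos Real.pi_pos]
    have g1 : ‖Gamma (4 - w)‖ ≤ M := by
      refine (norm_Gamma_le_Gamma_re (by rw [hre]; linarith)).trans ((le_abs_self _).trans (hM _ ?_))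
      rw [hre]; constructor <;> linarith
    have g2 : ‖sin (Real.pi * (w - 3))‖ ≤ Real.exp (Real.pi * |w.im|) := by
      refine (norm_sin_le_exp_abs_im _).trans_eq ?_
      simp [mul_im, abs_mul, abs_of_pos Real.pi_pos]
    refine (div_le_self (by positivity) (by linarith [Real.pi_gt_three])).trans ?_
    gcongr
  rw [e1, mul_inv, mul_inv, mul_inv, norm_mul, norm_mul, norm_mul]
  calc ‖(w - 1)⁻¹‖ * (‖(w - 2)⁻¹‖ * (‖(w - 3)⁻¹‖ * ‖(Gamma (w - 3))⁻¹‖))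
      ≤ 1 * (1 * (1 * (M * Real.exp (Real.pi * |w.im|)))) := by
        gcongr
        · exact hnorm _ (by simp)
        · exact hnorm _ (by simp)
        · exact hnorm _ (by simp)
    _ = _ := by ring

theorem riemannZeta₁_eq_mul {s : ℂ} (hs : s ≠ 1) : riemannZeta₁ s = (s - 1) * riemannZeta s := by
  rw [riemannZeta_eq_inv_sub_mul hs, mul_inv_cancel_left₀ (sub_ne_zero.2 hs)]

/-- A crude a priori bound: it serves only as the growth hypothesis of Phragmén–Lindelöf. -/
theorem exists_norm_riemannZeta₁_le_exp :
    ∃ M : ℝ, 0 ≤ M ∧ ∀ s : ℂ, -3 / 2 ≤ s.re → s.re ≤ 5 / 2 → 2 ≤ |s.im| →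
      ‖riemannZeta₁ s‖ ≤ M * Real.exp (4 * |s.im|) := by
  obtain ⟨M₀, hM₀, hΛ⟩ := exists_norm_completedRiemannZeta₀_le (-3 / 2) (5 / 2)
  obtain ⟨M₁, hM₁, hG⟩ := exists_norm_inv_Gamma_le
  refine ⟨(25 * M₀ + 1) * (Real.pi ^ 2 * M₁), by positivity, fun s h1 h2 h3 => ?_⟩
  have hs1 : s ≠ 1 := fun h => by rw [h] at h3; norm_num at h3
  have hs1' : 1 - s ≠ 0 := sub_ne_zero.2 hs1.symm
  rw [riemannZeta₁_eq_mul hs1, riemannZeta_eq_mul_completedRiemannZeta₀]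
  have e : (s - 1) * ((s * completedRiemannZeta₀ s - 1 - s / (1 - s)) /
      (2 * Real.pi ^ (-s / 2) * Gamma (s / 2 + 1))) =
      (s * (s - 1) * completedRiemannZeta₀ s + 1) * (2⁻¹ * ((Real.pi : ℂ) ^ (s / 2) *
        (Gamma (s / 2 + 1))⁻¹)) := by
    rw [show -s / 2 = -(s / 2) by ring, cpow_neg, div_eq_mul_inv, mul_inv, mul_inv, inv_inv]
    field_simp
    ring
  rw [e, norm_mul, norm_mul, norm_mul]
  have him : (s / 2 + 1).im = s.im / 2 := by simp
  have hre : (s / 2 + 1).re = s.re / 2 + 1 := by simp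
  have habs : |s.im / 2| = |s.im| / 2 := by rw [abs_div, abs_two]
  have g1 := hG (s / 2 + 1) (by rw [hre]; linarith) (by rw [hre]; linarith)
    (by rw [him, habs]; linarith)
  rw [him, habs] at g1
  have g2 : ‖(Real.pi : ℂ) ^ (s / 2)‖ ≤ Real.pi ^ 2 := by
    rw [norm_cpow_eq_rpow_re_of_pos Real.pi_pos, ← Real.rpow_natCast]
    refine Real.rpow_le_rpow_of_exponent_le (by linarith [Real.pi_gt_three]) ?_
    simp
    linarith
  set t := |s.im|
  have hsn : ‖s‖ ≤ 5 / 2 + t := (norm_le_abs_re_add_abs_im s).trans (by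
    gcongr; rw [abs_le]; constructor <;> linarith)
  have hsn' : ‖s - 1‖ ≤ 5 / 2 + t := (norm_le_abs_re_add_abs_im _).trans (by
    simp only [sub_re, one_re, sub_im, one_im, sub_zero]
    gcongr; rw [abs_le]; constructor <;> linarith)
  have hexp : 5 / 2 + t ≤ 5 * Real.exp (t / 2) := by
    have := Real.add_one_le_exp (t / 2)
    linarith
  have g3 : ‖s * (s - 1) * completedRiemannZeta₀ s + 1‖ ≤ (25 * M₀ + 1) * Real.exp t := by
    refine (norm_add_le _ _).trans ?_
    rw [norm_mul, norm_mul, norm_one]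
    have hΛs := hΛ s h1 h2
    have h1e : 1 ≤ Real.exp t := Real.one_le_exp (abs_nonneg _)
    calc ‖s‖ * ‖s - 1‖ * ‖completedRiemannZeta₀ s‖ + 1
        ≤ (5 * Real.exp (t / 2)) * (5 * Real.exp (t / 2)) * M₀ + Real.exp t := by
          gcongr
          · exact hsn.trans hexp
          · exact hsn'.trans hexp
      _ = 25 * (Real.exp (t / 2) * Real.exp (t / 2)) * M₀ + Real.exp t := by ring
      _ = _ := by rw [← Real.exp_add, add_halves]; ring
  have g4 : ‖(2 : ℂ)⁻¹‖ ≤ 1 := by norm_num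
  have ht : 0 ≤ t := abs_nonneg _
  calc ‖s * (s - 1) * completedRiemannZeta₀ s + 1‖ * (‖(2 : ℂ)⁻¹‖ * (‖(Real.pi : ℂ) ^ (s / 2)‖ *
        ‖(Gamma (s / 2 + 1))⁻¹‖))
      ≤ ((25 * M₀ + 1) * Real.exp t) * (1 * (Real.pi ^ 2 *
          (M₁ * Real.exp (Real.pi * (t / 2))))) := by gcongr
    _ = (25 * M₀ + 1) * (Real.pi ^ 2 * M₁) * Real.exp (t + Real.pi * (t / 2)) := by
        rw [Real.exp_add]; ring
    _ ≤ _ := by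
        gcongr
        nlinarith [Real.pi_lt_four]

/-- Polynomial growth of `(s - 1) ζ(s)` in the strip `-3/2 ≤ Re s ≤ 5/2`. -/
theorem exists_norm_riemannZeta₁_le :
    ∃ C : ℝ, 1 ≤ C ∧ ∀ s : ℂ, -3 / 2 ≤ s.re → s.re ≤ 5 / 2 →
      ‖riemannZeta₁ s‖ ≤ C * ‖s + 4‖ ^ 3 := by
  obtain ⟨M, hM, hexp⟩ := exists_norm_riemannZeta₁_le_exp
  obtain ⟨c, hc, hfe⟩ := exists_norm_riemannZeta_neg_three_half
  set S := ∑' n : ℕ, 1 / ((n : ℝ) + 1) ^ (5 / 2 : ℝ)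
  have hS : ∀ s : ℂ, s.re = 5 / 2 → ‖riemannZeta s‖ ≤ S := fun s hs =>
    norm_riemannZeta_le_tsum (by norm_num) hs.ge
  have hS0 : 0 ≤ S := (norm_nonneg _).trans (hS (5 / 2) (by norm_num))
  have h4 : ∀ s : ℂ, -3 / 2 ≤ s.re → 1 ≤ ‖s + 4‖ := fun s hs => by
    refine le_trans ?_ (re_le_norm _)
    simp; linarith
  have h4ne : ∀ s : ℂ, -3 / 2 ≤ s.re → s + 4 ≠ 0 := fun s hs h => by
    have := h4 s hs
    rw [h] at this
    norm_num at this
  have hle : ∀ s w : ℂ, s.im ^ 2 = w.im ^ 2 → |s.re| ≤ |w.re| → ‖s‖ ≤ ‖w‖ := fun s w h1 h2 => by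
    rw [← sq_le_sq₀ (norm_nonneg _) (norm_nonneg _), Complex.sq_norm, Complex.sq_norm,
      normSq_apply, normSq_apply]
    nlinarith [sq_le_sq.2 h2]
  refine ⟨max 1 (max S (c * S)), le_max_left _ _, fun s h1 h2 => ?_⟩
  set C := max 1 (max S (c * S))
  have hC0 : 0 ≤ C := zero_le_one.trans (le_max_left _ _)
  -- The cube absorbs three linear factors on the left edge: z - 1 and the two from the functional
  -- equation. The shift by 4 makes |z + 4| at least 1 and no smaller than each of them.
  have key : ‖riemannZeta₁ s / (s + 4) ^ 3‖ ≤ C := by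
    refine PhragmenLindelof.vertical_strip (a := -3 / 2) (b := 5 / 2)
      (f := fun z => riemannZeta₁ z / (z + 4) ^ 3) ?_ ?_ ?_ ?_ h1 h2
    · have hd : DifferentiableOn ℂ (fun z => riemannZeta₁ z / (z + 4) ^ 3)
          (re ⁻¹' Icc (-3 / 2) (5 / 2)) := fun z hz => by
        have hden : DifferentiableAt ℂ (fun z : ℂ => (z + 4) ^ 3) z := by fun_prop
        exact ((differentiable_riemannZeta₁ z).div hden
          (pow_ne_zero 3 (h4ne z hz.1))).differentiableWithinAt
      refine ⟨hd.mono (preimage_mono Ioo_subset_Icc_self), hd.continuousOn.mono ?_⟩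
      exact closure_minimal (preimage_mono Ioo_subset_Icc_self) (isClosed_Icc.preimage continuous_re)
    -- The strip has width 4, so the inner exponent must be below π/4; and 4t ≤ 8 e^{t/2}.
    · refine ⟨1 / 2, ?_, 8, IsBigO.of_bound M ?_⟩
      · rw [lt_div_iff₀ (by norm_num)]
        linarith [Real.pi_gt_three]
      · rw [eventually_inf_principal]
        have : ∀ᶠ z : ℂ in comap (abs ∘ im) atTop, 2 ≤ |z.im| :=
          (eventually_ge_atTop (2 : ℝ)).comap (abs ∘ im)
        filter_upwards [this] with z hz hz'
        have hz1 : -3 / 2 ≤ z.re := (mem_Ioo.1 hz').1.le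
        have hz2 : z.re ≤ 5 / 2 := (mem_Ioo.1 hz').2.le
        rw [norm_div, norm_pow, Real.norm_eq_abs, abs_of_pos (Real.exp_pos _)]
        refine (div_le_self (norm_nonneg _) (one_le_pow₀ (h4 z hz1))).trans
          ((hexp z hz1 hz2 hz).trans ?_)
        have := Real.add_one_le_exp (1 / 2 * |z.im|)
        exact mul_le_mul_of_nonneg_left (Real.exp_le_exp.2 (by linarith)) hM
    · intro z hz
      have hz1 : z ≠ 1 := fun h => by rw [h] at hz; norm_num at hz
      have hz4 := h4 z hz.ge
      rw [norm_div, norm_pow, div_le_iff₀ (by positivity), riemannZeta₁_eq_mul hz1, norm_mul]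
      have ez : z = -3 / 2 - ((-z.im : ℝ) : ℂ) * I := by
        apply Complex.ext <;> simp [hz]
      have := hfe (-z.im)
      rw [← ez] at this
      rw [this]
      have b1 : ‖z - 1‖ ≤ ‖z + 4‖ := hle _ _ (by simp) (by simp [hz]; norm_num)
      have b2 : ‖(3 / 2 + ((-z.im : ℝ) : ℂ) * I)‖ ≤ ‖z + 4‖ :=
        hle _ _ (by simp) (by simp [hz]; norm_num)
      have b3 : ‖(1 / 2 + ((-z.im : ℝ) : ℂ) * I)‖ ≤ ‖z + 4‖ :=
        hle _ _ (by simp) (by simp [hz]; norm_num)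
      have b4 := hS (5 / 2 + ((-z.im : ℝ) : ℂ) * I) (by simp)
      calc _ ≤ ‖z + 4‖ * (c * (‖z + 4‖ * ‖z + 4‖) * S) := by gcongr
        _ = (c * S) * ‖z + 4‖ ^ 3 := by ring
        _ ≤ C * ‖z + 4‖ ^ 3 := by
          gcongr
          exact (le_max_right _ _).trans (le_max_right _ _)
    · intro z hz
      have hz1 : z ≠ 1 := fun h => by rw [h] at hz; norm_num at hz
      have hz4 := h4 z (by rw [hz]; norm_num)
      rw [norm_div, norm_pow, div_le_iff₀ (by positivity), riemannZeta₁_eq_mul hz1, norm_mul]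
      have b1 : ‖z - 1‖ ≤ ‖z + 4‖ := hle _ _ (by simp) (by simp [hz]; norm_num)
      calc ‖z - 1‖ * ‖riemannZeta z‖ ≤ ‖z + 4‖ * S := by gcongr; exact hS z hz
        _ = S * ‖z + 4‖ ^ 1 := by ring
        _ ≤ C * ‖z + 4‖ ^ 3 := by
          gcongr
          · exact (le_max_left _ _).trans (le_max_right _ _)
          · norm_num
  rw [norm_div, norm_pow, div_le_iff₀ (by have := h4 s h1; positivity)] at key
  exact key

end ZetaStrip

/-! ### Upper bound for the number of zeros by Jensen's formula. -/

section ZeroCountUpper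

open Complex Set Topology

/-- Polynomial growth of `(s - 1) ζ(s)` in the half-plane `Re s ≥ -3/2`. -/
theorem exists_norm_riemannZeta₁_le_of_le_re :
    ∃ C : ℝ, 1 ≤ C ∧ ∀ s : ℂ, -3 / 2 ≤ s.re → ‖riemannZeta₁ s‖ ≤ C * ‖s + 4‖ ^ 3 := by
  obtain ⟨C, hC, h⟩ := exists_norm_riemannZeta₁_le
  refine ⟨max C (∑' n : ℕ, 1 / ((n : ℝ) + 1) ^ (5 / 2 : ℝ)), hC.trans (le_max_left _ _),
    fun s hs => ?_⟩
  rcases le_total s.re (5 / 2) with h2 | h2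
  · refine (h s hs h2).trans ?_
    gcongr
    exact le_max_left _ _
  · have hs1 : s ≠ 1 := fun h => by rw [h] at h2; norm_num at h2
    have h4 : 1 ≤ ‖s + 4‖ := by
      refine le_trans ?_ (re_le_norm _)
      simp; linarith
    have h14 : ‖s - 1‖ ≤ ‖s + 4‖ := by
      rw [← sq_le_sq₀ (norm_nonneg _) (norm_nonneg _), Complex.sq_norm, Complex.sq_norm,
        normSq_apply, normSq_apply]
      simp
      nlinarith
    have hz := norm_riemannZeta_le_tsum (by norm_num) h2
    have hS := (norm_nonneg _).trans hz
    rw [riemannZeta₁_eq_mul hs1, norm_mul, mul_comm]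
    gcongr ?_ * ?_
    · exact hz.trans (le_max_right _ _)
    · exact h14.trans (le_self_pow₀ h4 (by norm_num))

theorem riemannZeta₁_eventuallyEq {s : ℂ} (hs : s ≠ 1) :
    riemannZeta₁ =ᶠ[𝓝 s] (fun z => z - 1) * riemannZeta := by
  filter_upwards [isOpen_compl_singleton.mem_nhds hs] with z hz
  exact riemannZeta₁_eq_mul hz

theorem analyticAt_riemannZeta {s : ℂ} (hs : s ≠ 1) : AnalyticAt ℂ riemannZeta s :=
  analyticOn_riemannZeta s hs

theorem analyticOrderAt_riemannZeta₁ {s : ℂ} (hs : s ≠ 1) :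
    analyticOrderAt riemannZeta₁ s = analyticOrderAt riemannZeta s := by
  have h1 : AnalyticAt ℂ (fun z : ℂ => z - 1) s := by fun_prop
  rw [analyticOrderAt_congr (riemannZeta₁_eventuallyEq hs),
    analyticOrderAt_mul h1 (analyticAt_riemannZeta hs),
    h1.analyticOrderAt_eq_zero.2 (sub_ne_zero.2 hs), zero_add]

theorem analyticOrderAt_riemannZeta₁_ne_top (s : ℂ) : analyticOrderAt riemannZeta₁ s ≠ ⊤ := by
  intro h
  rw [analyticOrderAt_eq_top] at h
  have han : AnalyticOnNhd ℂ riemannZeta₁ univ := fun w _ =>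
    differentiable_riemannZeta₁.analyticAt w
  have := han.eqOn_zero_of_preconnected_of_eventuallyEq_zero isPreconnected_univ (mem_univ s) h
    (mem_univ 1)
  simp at this

theorem zetaZeros_ne_one {ρ : ℂ} (h : ρ ∈ zetaZeros) : ρ ≠ 1 := by
  rintro rfl
  simpa using h.2.2

theorem one_le_analyticOrderNatAt_riemannZeta {ρ : ℂ} (h : ρ ∈ zetaZeros) :
    1 ≤ analyticOrderNatAt riemannZeta ρ := by
  have hρ := zetaZeros_ne_one h
  have ht := analyticOrderAt_riemannZeta₁_ne_top ρ
  rw [analyticOrderAt_riemannZeta₁ hρ] at ht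
  rw [Nat.one_le_iff_ne_zero]
  intro h0
  have := Nat.cast_analyticOrderNatAt ht
  rw [h0] at this
  exact (analyticAt_riemannZeta hρ).analyticOrderAt_eq_zero.1 this.symm h.1

/-- Jensen's bound for the multiplicities of finitely many zeros in a disc. -/
theorem sum_analyticOrderNatAt_le_log {c : ℂ} {r R M : ℝ} (hr : 0 < r) (hrR : r < R) (hM : 1 ≤ M)
    (hc : riemannZeta₁ c ≠ 0) (hb : ∀ z ∈ Metric.sphere c R, ‖riemannZeta₁ z‖ ≤ M)
    (S : Finset ℂ) (hS : ∀ ρ ∈ S, ρ ∈ zetaZeros ∧ ρ ∈ Metric.closedBall c r) :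
    (∑ ρ ∈ S, analyticOrderNatAt riemannZeta ρ : ℝ) ≤
      Real.log (M / ‖riemannZeta₁ c‖) / Real.log (R / r) := by
  have hR : 0 < R := hr.trans hrR
  have han : ∀ U, AnalyticOnNhd ℂ riemannZeta₁ U := fun U w _ =>
    differentiable_riemannZeta₁.analyticAt w
  have h := AnalyticOnNhd.sum_divisor_le (f := riemannZeta₁) (c := c) (r := r) (R := R) (M := M)
    (by simpa using hr.ne') (by rwa [abs_of_pos hr, abs_of_pos hR]) hM (han _) hc
    (by rwa [abs_of_pos hR])
  refine le_trans ?_ h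
  rw [abs_of_pos hr]
  set D := MeromorphicOn.divisor riemannZeta₁ (Metric.closedBall c r)
  have hfin : (Function.support D).Finite := D.finiteSupport (isCompact_closedBall _ _)
  have hnn : ∀ u, 0 ≤ D u := fun u => (MeromorphicOn.AnalyticOnNhd.divisor_nonneg (han _)) u
  rw [finsum_eq_sum D hfin]
  have h1 : ∀ ρ ∈ S, (analyticOrderNatAt riemannZeta ρ : ℤ) = D ρ := fun ρ hρ => by
    have hne := zetaZeros_ne_one (hS ρ hρ).1
    have ht := analyticOrderAt_riemannZeta₁_ne_top ρ
    rw [MeromorphicOn.AnalyticOnNhd.divisor_apply (han _) (hS ρ hρ).2,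
      ← Nat.cast_analyticOrderNatAt ht, analyticOrderNatAt, analyticOrderNatAt,
      analyticOrderAt_riemannZeta₁ hne]
    simp
  have h2 : (∑ ρ ∈ S, (analyticOrderNatAt riemannZeta ρ : ℤ)) ≤ ∑ u ∈ hfin.toFinset, D u := by
    rw [Finset.sum_congr rfl h1]
    have e : ∑ ρ ∈ S, D ρ = ∑ ρ ∈ S ∩ hfin.toFinset, D ρ := by
      symm
      refine Finset.sum_subset Finset.inter_subset_left fun x hx hx' => ?_
      by_contra h0
      exact hx' (Finset.mem_inter.2 ⟨hx, hfin.mem_toFinset.2 h0⟩)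
    rw [e]
    exact Finset.sum_le_sum_of_subset_of_nonneg Finset.inter_subset_right fun u _ _ => hnn u
  exact_mod_cast h2

/-- Jensen on discs centred at 2 + i(n + 1/2), where ζ is bounded below. Radius 21/10 covers the
window since 2² + (1/2)² < (21/10)², and radius 5/2 stays where growth is polynomial. -/
theorem exists_sum_analyticOrderNatAt_window_le :
    ∃ K : ℝ, 0 < K ∧ ∀ (n : ℕ) (S : Finset ℂ),
      (∀ ρ ∈ S, ρ ∈ zetaZeros ∧ (n : ℝ) ≤ ρ.im ∧ ρ.im ≤ n + 1) →
      (∑ ρ ∈ S, analyticOrderNatAt riemannZeta ρ : ℝ) ≤ K * Real.log (n + 9) := by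
  obtain ⟨C, hC, hgrow⟩ := exists_norm_riemannZeta₁_le_of_le_re
  obtain ⟨c₀, hc₀, hc₁, hlow⟩ := exists_le_norm_riemannZeta_of_re_eq_two
  have hk : 0 < Real.log ((5 / 2) / (21 / 10)) := Real.log_pos (by norm_num)
  have hCc : 0 ≤ Real.log (C / c₀) := Real.log_nonneg (by rw [le_div_iff₀ hc₀]; linarith)
  refine ⟨(Real.log (C / c₀) + 3) / Real.log ((5 / 2) / (21 / 10)), by positivity,
    fun n S hS => ?_⟩
  set c : ℂ := 2 + ((n + 1 / 2 : ℝ) : ℂ) * I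
  have hcre : c.re = 2 := by simp [c]
  have hcim : c.im = n + 1 / 2 := by simp [c]
  have hc1 : c ≠ 1 := fun h => by rw [h] at hcre; norm_num at hcre
  have hcn : c₀ ≤ ‖riemannZeta₁ c‖ := by
    rw [riemannZeta₁_eq_mul hc1, norm_mul]
    have h1 : 1 ≤ ‖c - 1‖ := by
      refine le_trans ?_ (re_le_norm _)
      rw [sub_re, hcre]; norm_num
    nlinarith [hlow c hcre]
  have hn : (0 : ℝ) ≤ n := n.cast_nonneg
  have hM : (1 : ℝ) ≤ C * (n + 9) ^ 3 := by
    have : (1 : ℝ) ≤ (n + 9) ^ 3 := one_le_pow₀ (by linarith)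
    nlinarith
  have hJ := sum_analyticOrderNatAt_le_log (c := c) (r := 21 / 10) (R := 5 / 2)
    (M := C * (n + 9) ^ 3) (by norm_num) (by norm_num) hM
    (fun h => by rw [h, norm_zero] at hcn; linarith) (fun z hz => ?_) S (fun ρ hρ => ?_)
  · refine hJ.trans ?_
    rw [div_mul_eq_mul_div]
    gcongr
    have hl : 1 ≤ Real.log (n + 9) := by
      rw [Real.le_log_iff_exp_le (by linarith)]
      linarith [Real.exp_one_lt_d9]
    calc Real.log (C * (n + 9) ^ 3 / ‖riemannZeta₁ c‖)
        ≤ Real.log (C / c₀ * (n + 9) ^ 3) := by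
          have h3 : C * ((n : ℝ) + 9) ^ 3 / ‖riemannZeta₁ c‖ ≤ C * (n + 9) ^ 3 / c₀ := by gcongr
          refine Real.log_le_log (div_pos (by linarith) (hc₀.trans_le hcn)) (h3.trans_eq ?_)
          ring
      _ = Real.log (C / c₀) + 3 * Real.log (n + 9) := by
          rw [Real.log_mul (by positivity) (by positivity), Real.log_pow]
          norm_num
      _ ≤ (Real.log (C / c₀) + 3) * Real.log (n + 9) := by nlinarith
  · have hd : ‖z - c‖ = 5 / 2 := by simpa [dist_eq_norm] using hz
    have hre : |(z - c).re| ≤ 5 / 2 := hd ▸ abs_re_le_norm _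
    rw [sub_re, hcre, abs_le] at hre
    refine (hgrow z (by linarith)).trans ?_
    have h4 : ‖z + 4‖ ≤ n + 9 := by
      have h5 : ‖c + 4‖ ≤ 6 + (n + 1 / 2) := by
        refine (norm_le_abs_re_add_abs_im _).trans_eq ?_
        simp only [add_re, add_im, hcre, hcim]
        norm_num
        positivity
      calc ‖z + 4‖ = ‖(z - c) + (c + 4)‖ := by ring_nf
        _ ≤ _ := norm_add_le _ _
        _ ≤ _ := by rw [hd]; linarith
    gcongr
  · obtain ⟨h1, h2, h3⟩ := hS ρ hρ
    refine ⟨h1, ?_⟩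
    obtain ⟨-, h5, h6⟩ := h1
    rw [Metric.mem_closedBall, dist_eq_norm, ← sq_le_sq₀ (norm_nonneg _) (by norm_num),
      Complex.sq_norm, normSq_apply, sub_re, sub_im, hcre, hcim]
    nlinarith

/-- `N(T) ≪ T log T`. -/
theorem exists_zeroCount_le :
    ∃ K : ℝ, 0 < K ∧ ∀ T : ℝ, 0 ≤ T → (zeroCount T : ℝ) ≤ K * ((T + 1) * Real.log (T + 9)) := by
  obtain ⟨K, hK, hwin⟩ := exists_sum_analyticOrderNatAt_window_le
  refine ⟨K, hK, fun T hT => ?_⟩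
  rw [zeroCount, ← Finset.sum_fiberwise_of_maps_to (g := fun ρ : ℂ => ⌊ρ.im⌋₊)
    (t := Finset.range (⌊T⌋₊ + 1))]
  · push_cast
    calc _ ≤ ∑ n ∈ Finset.range (⌊T⌋₊ + 1), K * Real.log (T + 9) := by
          refine Finset.sum_le_sum fun n hn => ?_
          have hn' : n ≤ ⌊T⌋₊ := Nat.lt_succ_iff.1 (Finset.mem_range.1 hn)
          have hnT : (n : ℝ) ≤ T := (Nat.cast_le.2 hn').trans (Nat.floor_le hT)
          refine (hwin n _ fun ρ hρ => ?_).trans ?_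
          · rw [Finset.mem_filter, Finite.mem_toFinset] at hρ
            obtain ⟨⟨h1, h2, h3⟩, rfl⟩ := hρ
            exact ⟨h1, Nat.floor_le h2, (Nat.lt_floor_add_one _).le⟩
          · gcongr
      _ = (⌊T⌋₊ + 1 : ℝ) * (K * Real.log (T + 9)) := by simp
      _ ≤ (T + 1) * (K * Real.log (T + 9)) := by
          have : 0 ≤ Real.log (T + 9) := Real.log_nonneg (by linarith)
          gcongr
          exact Nat.floor_le hT
      _ = _ := by ring
  · intro ρ hρ
    rw [Finite.mem_toFinset] at hρ
    exact Finset.mem_range.2 (Nat.lt_succ_iff.2 (Nat.floor_le_floor hρ.2.2))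

end ZeroCountUpper

/-! ### Lower bound for the number of zeros: gaps between ordinates are bounded. -/

section ZeroCountLower

open Complex Set Topology

/-- Interpolation between two concentric discs through Taylor coefficients. -/
theorem norm_le_geom_sum_add_of_norm_le {g : ℂ → ℂ} {r₁ r₂ r R A M : ℝ} (hr₁ : 0 < r₁)
    (hrr : r < r₂) (h1 : r₁ < R) (h2 : r₂ < R) (hr : 0 ≤ r)
    (hg : DifferentiableOn ℂ g (Metric.ball 0 R))
    (hA : ∀ z, ‖z‖ ≤ r₁ → ‖g z‖ ≤ A) (hM : ∀ z, ‖z‖ ≤ r₂ → ‖g z‖ ≤ M) (N : ℕ)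
    {z : ℂ} (hz : ‖z‖ ≤ r) :
    ‖g z‖ ≤ ∑ n ∈ Finset.range N, A * (r / r₁) ^ n + M * (r / r₂) ^ N * (1 - r / r₂)⁻¹ := by
  have hr₂ : 0 < r₂ := hr.trans_lt hrr
  have hq0 : 0 ≤ r / r₂ := by positivity
  have hq1 : r / r₂ < 1 := (div_lt_one hr₂).2 hrr
  set a : ℕ → ℂ := fun n => ((n.factorial : ℂ)⁻¹ • (z - 0) ^ n • iteratedDeriv n g 0)
  have hsum : HasSum a (g z) := hasSum_taylorSeries_on_ball hg
    (by rw [mem_ball_zero_iff]; linarith)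
  have hcoef : ∀ ρ K : ℝ, 0 < ρ → ρ < R → (∀ z, ‖z‖ ≤ ρ → ‖g z‖ ≤ K) → ∀ n,
      ‖a n‖ ≤ K * (r / ρ) ^ n := fun ρ K hρ hρR hK n => by
    have hK0 : 0 ≤ K := (norm_nonneg _).trans (hK 0 (by simpa using hρ.le))
    have hd : DiffContOnCl ℂ g (Metric.ball 0 ρ) :=
      DifferentiableOn.diffContOnCl (hg.mono (Metric.closure_ball_subset_closedBall.trans
        (Metric.closedBall_subset_ball hρR)))
    have := norm_iteratedDeriv_le_of_forall_mem_sphere_norm_le n hρ hd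
      (fun z hz => hK z (by simpa using (mem_sphere_zero_iff_norm.1 hz).le))
    simp only [a, norm_smul, norm_inv, norm_natCast, norm_pow, sub_zero]
    have hn : (0 : ℝ) < n.factorial := by exact_mod_cast n.factorial_pos
    calc (n.factorial : ℝ)⁻¹ * (‖z‖ ^ n * ‖iteratedDeriv n g 0‖)
        ≤ (n.factorial : ℝ)⁻¹ * (r ^ n * (n.factorial * K / ρ ^ n)) := by gcongr
      _ = K * (r / ρ) ^ n := by rw [div_pow]; field_simp
  -- Cauchy's estimates on the small disc serve for the first N coefficients, those on the large
  -- disc for the remaining ones.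
  have hA' := hcoef r₁ A hr₁ h1 hA
  have hM' := hcoef r₂ M hr₂ h2 hM
  rw [← hsum.tsum_eq, ← hsum.summable.sum_add_tsum_nat_add N]
  refine (norm_add_le _ _).trans (add_le_add ?_ ?_)
  · exact (norm_sum_le _ _).trans (Finset.sum_le_sum fun n _ => hA' n)
  · refine tsum_of_norm_bounded ((hasSum_geometric_of_lt_one hq0 hq1).mul_left _) fun n => ?_
    refine (hM' (n + N)).trans_eq ?_
    rw [pow_add]; ring

/-- A nonvanishing holomorphic function on a disc has a holomorphic logarithm. -/
theorem exists_differentiableOn_exp_eq {f : ℂ → ℂ} {R : ℝ}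
    (hR : 0 < R) (hf : DifferentiableOn ℂ f (Metric.ball 0 R))
    (h0 : ∀ z ∈ Metric.ball (0 : ℂ) R, f z ≠ 0) :
    ∃ g : ℂ → ℂ, DifferentiableOn ℂ g (Metric.ball 0 R) ∧ g 0 = log (f 0) ∧
      ∀ z ∈ Metric.ball (0 : ℂ) R, exp (g z) = f z := by
  have hmem : (0 : ℂ) ∈ Metric.ball (0 : ℂ) R := Metric.mem_ball_self hR
  -- The logarithm is a primitive g of f'/f: then f e^{-g} has zero derivative.
  have hlog : DifferentiableOn ℂ (fun z => deriv f z / f z) (Metric.ball 0 R) :=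
    (hf.deriv Metric.isOpen_ball).div hf h0
  obtain ⟨g, hg0, hg⟩ := hlog.isExactOn_ball.with_val_at 0 (log (f 0))
  refine ⟨g, fun z hz => (hg z hz).differentiableAt.differentiableWithinAt, hg0, fun z hz => ?_⟩
  have hder : ∀ w ∈ Metric.ball (0 : ℂ) R, HasDerivAt (fun w => f w * exp (-g w)) 0 w :=
    fun w hw => by
    have hfw : HasDerivAt f (deriv f w) w :=
      (hf.differentiableAt (Metric.isOpen_ball.mem_nhds hw)).hasDerivAt
    have hfw0 := h0 w hw
    refine (hfw.mul (hg w hw).neg.cexp).congr_deriv ?_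
    simp only [Pi.neg_apply]
    field_simp
    ring
  have hconst := Metric.isOpen_ball.is_const_of_deriv_eq_zero
    (convex_ball (0 : ℂ) R).isPreconnected
    (fun w hw => (hder w hw).differentiableAt.differentiableWithinAt)
    (fun w hw => (hder w hw).deriv) hz hmem
  simp only [hg0, exp_neg, exp_log (h0 0 hmem)] at hconst
  rw [mul_inv_cancel₀ (h0 0 hmem), ← div_eq_mul_inv, div_eq_one_iff_eq (exp_ne_zero _)] at hconst
  exact hconst.symm

/-- For Re s ≤ 0 off the real axis, no factor of the functional equation vanishes. This is needed
because the discs below extend to the left of the critical strip. -/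
theorem mem_zetaZeros_of_im_pos {s : ℂ} (h0 : riemannZeta s = 0) (him : 0 < s.im) :
    s ∈ zetaZeros := by
  have hlt : s.re < 1 := by
    by_contra h
    exact riemannZeta_ne_zero_of_one_le_re (not_lt.1 h) h0
  refine ⟨h0, ?_, hlt⟩
  by_contra h
  have hne : ∀ x : ℂ, x.im = 0 → 1 - s ≠ x := fun x hx h => by
    rw [← h] at hx
    simp at hx
    linarith
  have hfe := riemannZeta_one_sub (s := 1 - s) (fun n => hne _ (by simp)) (hne _ (by simp))
  rw [sub_sub_cancel, h0, eq_comm] at hfe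
  have hG : Gamma (1 - s) ≠ 0 := Gamma_ne_zero_of_re_pos (by simp; linarith)
  have hz : riemannZeta (1 - s) ≠ 0 := riemannZeta_ne_zero_of_one_le_re (by simp; linarith)
  have hc : cos (Real.pi * (1 - s) / 2) ≠ 0 := by
    rw [Ne, cos_eq_zero_iff]
    rintro ⟨k, hk⟩
    have := congrArg im hk
    rw [show (Real.pi : ℂ) * (1 - s) / 2 = (Real.pi / 2 : ℝ) * (1 - s) by push_cast; ring,
      show (2 * k + 1 : ℂ) * Real.pi / 2 = ((2 * k + 1) * Real.pi / 2 : ℝ) by push_cast; ring,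
      im_ofReal_mul, ofReal_im] at this
    simp [Real.pi_ne_zero] at this
    linarith
  simp [hG, hz, hc] at hfe

theorem norm_riemannZeta_conj (s : ℂ) :
    ‖riemannZeta ((starRingEnd ℂ) s)‖ = ‖riemannZeta s‖ := by
  rw [riemannZeta_conj, norm_conj]

/-- If `ζ` has no zeros near height `T`, then `log |ζ|` is small there. -/
theorem exists_abs_log_norm_riemannZeta_le :
    ∃ B : ℝ, ∀ T : ℝ, 5 ≤ T → (∀ ρ ∈ zetaZeros, 13 / 4 ≤ |ρ.im - T|) →
      ∀ x : ℝ, |x| ≤ 5 / 2 →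
        |Real.log ‖riemannZeta (2 + T * I + x)‖| ≤ B + 1 / 8 * Real.log (T + 10) := by
  obtain ⟨C, hC, hgrow⟩ := exists_norm_riemannZeta₁_le_of_le_re
  obtain ⟨c₀, hc₀, hc₁, hlow⟩ := exists_le_norm_riemannZeta_of_re_eq_two
  set S := ∑' n : ℕ, 1 / ((n : ℝ) + 1) ^ (3 / 2 : ℝ)
  have hS : ∀ s : ℂ, 3 / 2 ≤ s.re → ‖riemannZeta s‖ ≤ S := fun s hs =>
    norm_riemannZeta_le_tsum (by norm_num) hs
  set b : ℝ := |Real.log S| + 1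
  set G : ℝ := (|Real.log c₀| + |Real.log S|) + Real.pi
  have hG : 0 ≤ G := by positivity
  have hb : 0 < b := by positivity
  -- The factors are 3 log(T+10) in the growth bound, 24 from Borel–Carathéodory and 6 = 1/(1 - 5/6)
  -- from the geometric tail; the choice of N leaves 1/8.
  obtain ⟨N, hN⟩ := exists_pow_lt_of_lt_one (show (0 : ℝ) < 1 / (8 * 3 * 24 * 6) by norm_num)
    (show (5 / 6 : ℝ) < 1 by norm_num)
  refine ⟨∑ n ∈ Finset.range N, (2 * b + 3 * G) * ((5 / 2) / (1 / 4)) ^ n +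
    6 * (24 * Real.log C + 25 * G), fun T hT hfree x hx => ?_⟩
  set c : ℂ := 2 + T * I
  have hcre : c.re = 2 := by simp [c]
  have hcim : c.im = T := by simp [c]
  have hC0 : 0 ≤ Real.log C := Real.log_nonneg hC
  have hball : ∀ z ∈ Metric.ball (0 : ℂ) (13 / 4), |(c + z).im - T| < 13 / 4 ∧
      -5 / 4 ≤ (c + z).re := fun z hz => by
    have hz : ‖z‖ < 13 / 4 := mem_ball_zero_iff.1 hz
    have h1 := (abs_le.1 (abs_re_le_norm z)).1
    refine ⟨?_, ?_⟩
    · rw [add_im, hcim, add_sub_cancel_left]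
      exact (abs_im_le_norm z).trans_lt hz
    · rw [add_re, hcre]; linarith
  have him : ∀ z ∈ Metric.ball (0 : ℂ) (13 / 4), 1 ≤ (c + z).im := fun z hz => by
    have := (abs_lt.1 (hball z hz).1).1
    linarith
  have hne1 : ∀ z ∈ Metric.ball (0 : ℂ) (13 / 4), c + z ≠ 1 := fun z hz h => by
    have := him z hz
    rw [h] at this
    norm_num at this
  have hf0 : ∀ z ∈ Metric.ball (0 : ℂ) (13 / 4), riemannZeta (c + z) ≠ 0 := fun z hz h =>
    (hfree _ (mem_zetaZeros_of_im_pos h (by linarith [him z hz]))).not_gt (hball z hz).1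
  obtain ⟨g, hgd, hg0, hg⟩ := exists_differentiableOn_exp_eq (f := fun z => riemannZeta (c + z))
    (by norm_num : (0 : ℝ) < 13 / 4)
    (fun z hz => ((differentiableAt_riemannZeta (hne1 z hz)).comp z
      (by fun_prop : DifferentiableAt ℂ (fun z => c + z) z)).differentiableWithinAt) hf0
  have hre : ∀ z ∈ Metric.ball (0 : ℂ) (13 / 4), (g z).re = Real.log ‖riemannZeta (c + z)‖ :=
    fun z hz => by rw [← hg z hz, norm_exp, Real.log_exp]
  set M : ℝ := Real.log C + 3 * Real.log (T + 10)
  have hlT : 0 < Real.log (T + 10) := Real.log_pos (by linarith)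
  have hM : 0 < M := by positivity
  have hreM : MapsTo g (Metric.ball 0 (13 / 4)) {z | z.re ≤ M} := fun z hz => by
    rw [mem_ofPred_eq, hre z hz]
    have hsub : 1 ≤ ‖c + z - 1‖ := by
      refine (him z hz).trans ((le_abs_self _).trans ?_)
      have := abs_im_le_norm (c + z - 1)
      simpa using this
    have h1 : ‖riemannZeta (c + z)‖ ≤ C * (T + 10) ^ 3 := by
      calc ‖riemannZeta (c + z)‖ ≤ ‖c + z - 1‖ * ‖riemannZeta (c + z)‖ :=
            le_mul_of_one_le_left (norm_nonneg _) hsub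
        _ = ‖riemannZeta₁ (c + z)‖ := by rw [riemannZeta₁_eq_mul (hne1 z hz), norm_mul]
        _ ≤ C * ‖c + z + 4‖ ^ 3 := hgrow _ (by linarith [(hball z hz).2])
        _ ≤ C * (T + 10) ^ 3 := by
          have : ‖c + z + 4‖ ≤ T + 10 := by
            have h5 : ‖c + 4‖ ≤ 6 + T := by
              refine (norm_le_abs_re_add_abs_im _).trans_eq ?_
              simp only [add_re, add_im, hcre, hcim]
              norm_num
              linarith
            calc ‖c + z + 4‖ = ‖(c + 4) + z‖ := by ring_nf
              _ ≤ _ := norm_add_le _ _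
              _ ≤ _ := by linarith [mem_ball_zero_iff.1 hz]
          gcongr
    calc Real.log ‖riemannZeta (c + z)‖ ≤ Real.log (C * (T + 10) ^ 3) :=
          Real.log_le_log (norm_pos_iff.2 (hf0 z hz)) h1
      _ = M := by
          rw [Real.log_mul (by positivity) (by positivity), Real.log_pow]
          norm_num [M]
  have hg0n : ‖g 0‖ ≤ G := by
    rw [hg0, add_zero]
    refine (norm_le_abs_re_add_abs_im _).trans ?_
    rw [log_re, log_im]
    refine add_le_add ?_ (abs_arg_le_pi _)
    have h1 := Real.log_le_log hc₀ (hlow c hcre)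
    have h2 := Real.log_le_log (hc₀.trans_le (hlow c hcre)) (hS c (by rw [hcre]; norm_num))
    have h3 := neg_abs_le (Real.log c₀)
    have h4 := le_abs_self (Real.log S)
    rw [abs_le]
    constructor <;> linarith [abs_nonneg (Real.log c₀), abs_nonneg (Real.log S)]
  -- Borel–Carathéodory from radius 13/4 to 3: 2·3/(1/4) = 24 and (13/4 + 3)/(1/4) = 25.
  have hbig : ∀ z : ℂ, ‖z‖ ≤ 3 → ‖g z‖ ≤ 24 * M + 25 * G := fun z hz => by
    have h := borelCaratheodory hM hgd hreM (by norm_num)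
      (mem_ball_zero_iff.2 (by linarith : ‖z‖ < 13 / 4))
    refine h.trans ?_
    have hd : 0 < 13 / 4 - ‖z‖ := by linarith
    rw [← add_div, div_le_iff₀ hd]
    nlinarith [mul_le_mul hg0n (by linarith : 13 / 4 + ‖z‖ ≤ 25 / 4) (by positivity) hG,
      mul_le_mul_of_nonneg_left hz hM.le, mul_le_mul_of_nonneg_left hz hG]
  -- Within 1/2 of the centre Re s ≥ 3/2, so |ζ| ≤ S and the bound does not depend on T.
  have hsmall : ∀ z : ℂ, ‖z‖ ≤ 1 / 4 → ‖g z‖ ≤ 2 * b + 3 * G := fun z hz => by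
    have hsub : Metric.ball (0 : ℂ) (1 / 2) ⊆ Metric.ball 0 (13 / 4) :=
      Metric.ball_subset_ball (by norm_num)
    have h := borelCaratheodory hb (hgd.mono hsub) (fun w hw => by
      rw [mem_ofPred_eq, hre w (hsub hw)]
      have hw' := (abs_le.1 ((abs_re_le_norm w).trans (mem_ball_zero_iff.1 hw).le)).1
      refine (Real.log_le_log (norm_pos_iff.2 (hf0 w (hsub hw)))
        (hS (c + w) (by rw [add_re, hcre]; linarith))).trans ?_
      linarith [le_abs_self (Real.log S)]) (by norm_num)
      (mem_ball_zero_iff.2 (by linarith : ‖z‖ < 1 / 2))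
    refine h.trans ?_
    have hd : 0 < 1 / 2 - ‖z‖ := by linarith
    rw [← add_div, div_le_iff₀ hd]
    nlinarith [mul_le_mul hg0n (by linarith : 1 / 2 + ‖z‖ ≤ 3 / 4) (by positivity) hG,
      mul_le_mul_of_nonneg_left hz hb.le, mul_le_mul_of_nonneg_left hz hG]
  have hxn : ‖(x : ℂ)‖ ≤ 5 / 2 := by rwa [norm_real, Real.norm_eq_abs]
  have hfin := norm_le_geom_sum_add_of_norm_le (r₁ := 1 / 4) (r₂ := 3) (r := 5 / 2)
    (R := 13 / 4) (by norm_num) (by norm_num) (by norm_num) (by norm_num) (by norm_num) hgd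
    hsmall hbig N hxn
  rw [← hre x (mem_ball_zero_iff.2 (by linarith))]
  refine (abs_re_le_norm _).trans (hfin.trans ?_)
  rw [show (5 / 2 / 3 : ℝ) = 5 / 6 by norm_num, show (1 - 5 / 6 : ℝ)⁻¹ = 6 by norm_num, add_assoc]
  gcongr
  have hN1 : (5 / 6 : ℝ) ^ N ≤ 1 := pow_le_one₀ (by norm_num) (by norm_num)
  have e1 : (24 * Real.log C + 25 * G) * (5 / 6 : ℝ) ^ N ≤ 24 * Real.log C + 25 * G :=
    mul_le_of_le_one_right (by positivity) hN1
  have e2 := mul_le_mul_of_nonneg_left hN.le hlT.le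
  simp only [M]
  nlinarith

/-- For all large `T` there is a non-trivial zero within distance `13/4` of height `T`. -/
theorem exists_zetaZero_near :
    ∃ T₁ : ℝ, ∀ T : ℝ, T₁ ≤ T → ∃ ρ ∈ zetaZeros, |ρ.im - T| < 13 / 4 := by
  obtain ⟨B, hB⟩ := exists_abs_log_norm_riemannZeta_le
  obtain ⟨c, hc, hfe⟩ := exists_norm_riemannZeta_neg_half
  refine ⟨max 10 (Real.exp (4 * B + 2 * |Real.log c| + 2)), fun T hT => ?_⟩
  by_contra! hno
  have hT10 : 10 ≤ T := (le_max_left _ _).trans hT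
  have hT0 : 0 < T := by linarith
  -- At -1/2 + iT and 3/2 + iT the logarithms differ by at most 2B + (1/4) log(T+10), whereas the
  -- functional equation makes them differ by at least log T + log c.
  have h1 := hB T (by linarith) hno (-5 / 2) (by norm_num [abs_of_neg])
  have h2 := hB T (by linarith) hno (-1 / 2) (by norm_num [abs_of_neg])
  have e := hfe (-T)
  have e1 : (-1 / 2 - ((-T : ℝ) : ℂ) * I) = 2 + T * I + ((-5 / 2 : ℝ) : ℂ) := by
    push_cast; ring
  have e2 : (3 / 2 + ((-T : ℝ) : ℂ) * I) = (starRingEnd ℂ) (2 + T * I + ((-1 / 2 : ℝ) : ℂ)) := by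
    simp only [map_add, map_mul, conj_ofReal, conj_I, map_ofNat]
    push_cast
    ring
  rw [e1, e2, norm_riemannZeta_conj] at e
  have hT1 : T ≤ ‖(1 / 2 + ((-T : ℝ) : ℂ) * I)‖ := by
    refine le_trans ?_ (abs_im_le_norm _)
    simp [abs_of_pos hT0]
  have hpos : 0 < ‖(1 / 2 + ((-T : ℝ) : ℂ) * I)‖ := hT0.trans_le hT1
  have hz : riemannZeta (2 + T * I + ((-1 / 2 : ℝ) : ℂ)) ≠ 0 :=
    riemannZeta_ne_zero_of_one_le_re (by simp; norm_num)
  rw [e, Real.log_mul (by positivity) (norm_ne_zero_iff.2 hz), Real.log_mul hc.ne' hpos.ne'] at h1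
  have hlog := Real.log_le_log hT0 hT1
  have hlog2 : Real.log (T + 10) ≤ Real.log T + 1 := by
    rw [← Real.log_exp 1, ← Real.log_mul hT0.ne' (Real.exp_pos 1).ne']
    exact Real.log_le_log (by linarith) (by nlinarith [Real.add_one_le_exp (1 : ℝ)])
  have hlT : 4 * B + 2 * |Real.log c| + 2 ≤ Real.log T :=
    (Real.le_log_iff_exp_le hT0).2 ((le_max_right _ _).trans hT)
  have hlT0 : 0 < Real.log T := Real.log_pos (by linarith)
  have a1 := (abs_le.1 h1).2
  have a2 := (abs_le.1 h2).1
  have a3 := neg_abs_le (Real.log c)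
  have a4 := abs_nonneg (Real.log c)
  linarith

/-- `N(T) ≫ T`. -/
theorem exists_le_zeroCount :
    ∃ T₂ : ℝ, ∀ T : ℝ, T₂ ≤ T → T / 8 ≤ zeroCount T := by
  obtain ⟨T₁, hT₁⟩ := exists_zetaZero_near
  set T₀ : ℝ := max T₁ 4
  have hT₀ : 4 ≤ T₀ := le_max_right _ _
  -- The spacing 7 exceeds 2·(13/4), so the chosen zeros are distinct. There are about T/7 of them,
  -- and T/8 absorbs the boundary terms.
  have hex : ∀ j : ℕ, ∃ ρ ∈ zetaZeros, |ρ.im - (T₀ + 7 * j)| < 13 / 4 := fun j =>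
    hT₁ _ ((le_max_left T₁ 4).trans (by
      have := j.cast_nonneg (α := ℝ)
      linarith))
  choose ρ hρ hρT using hex
  refine ⟨8 * T₀ + 40, fun T hT => ?_⟩
  set J := ⌊(T - T₀ - 4) / 7⌋₊
  have hJ : (J : ℝ) ≤ (T - T₀ - 4) / 7 := Nat.floor_le (by linarith)
  have hJ' : (T - T₀ - 4) / 7 < J + 1 := Nat.lt_floor_add_one _
  have hinj : Function.Injective ρ := fun i j hij => by
    have h1 := abs_lt.1 (hρT i)
    have h2 := abs_lt.1 (hρT j)
    rw [hij] at h1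
    by_contra hne
    rcases lt_or_gt_of_ne hne with h | h
    · have : (i : ℝ) + 1 ≤ j := by exact_mod_cast h
      linarith [h1.2, h2.1]
    · have : (j : ℝ) + 1 ≤ i := by exact_mod_cast h
      linarith [h1.1, h2.2]
  have hsub : (Finset.range (J + 1)).map ⟨ρ, hinj⟩ ⊆ (zetaZeros_finite T).toFinset := by
    intro z hz
    obtain ⟨j, hj, rfl⟩ := Finset.mem_map.1 hz
    have hj' : (j : ℝ) ≤ J := by exact_mod_cast Nat.lt_succ_iff.1 (Finset.mem_range.1 hj)
    have h1 := abs_lt.1 (hρT j)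
    have := j.cast_nonneg (α := ℝ)
    rw [Finite.mem_toFinset]
    refine ⟨hρ j, ?_, ?_⟩ <;> simp only [Function.Embedding.coeFn_mk] <;> linarith [h1.1, h1.2]
  have hcard : J + 1 ≤ zeroCount T := by
    calc J + 1 = ∑ z ∈ (Finset.range (J + 1)).map ⟨ρ, hinj⟩, 1 := by simp
      _ ≤ ∑ z ∈ (Finset.range (J + 1)).map ⟨ρ, hinj⟩, analyticOrderNatAt riemannZeta z := by
        refine Finset.sum_le_sum fun z hz => one_le_analyticOrderNatAt_riemannZeta ?_
        obtain ⟨j, -, rfl⟩ := Finset.mem_map.1 hz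
        exact hρ j
      _ ≤ zeroCount T := Finset.sum_le_sum_of_subset hsub
  have : ((J : ℝ) + 1) ≤ zeroCount T := by exact_mod_cast hcard
  linarith

end ZeroCountLower

/-! ### Moments of a trigonometric polynomial against those of the random model. -/

section Moments

open Complex

/-- The net number of occurrences of `i` in a word of signed letters. -/
def signedCount {ι : Type*} [DecidableEq ι] {k : ℕ} (p : Fin k → ι × Bool) (i : ι) : ℤ :=
  ∑ j, if (p j).1 = i then (if (p j).2 then 1 else -1) else 0

theorem abs_signedCount_le {ι : Type*} [DecidableEq ι] {k : ℕ} (p : Fin k → ι × Bool)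
    (i : ι) : |signedCount p i| ≤ k := by
  refine (Finset.abs_sum_le_sum_abs _ _).trans ?_
  calc _ ≤ ∑ _j : Fin k, (1 : ℤ) := Finset.sum_le_sum fun j _ => by split_ifs <;> simp
    _ = k := by simp

theorem sum_signedCount_mul {ι : Type*} [Fintype ι] [DecidableEq ι] {k : ℕ}
    (p : Fin k → ι × Bool) (x : ι → ℝ) :
    ∑ i, (signedCount p i : ℝ) * x i = ∑ j, (if (p j).2 then 1 else -1) * x (p j).1 := by
  simp only [signedCount, Int.cast_sum, Finset.sum_mul]
  rw [Finset.sum_comm]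
  refine Finset.sum_congr rfl fun j _ => ?_
  rw [Finset.sum_eq_single (p j).1]
  · split_ifs <;> simp_all
  · intro i _ hi
    simp [hi.symm]
  · simp

theorem sum_mul_cos_eq {ι : Type*} [Fintype ι] (a x : ι → ℝ) :
    ((∑ i, a i * Real.cos (x i) : ℝ) : ℂ) =
      ∑ q : ι × Bool, ((a q.1 / 2 : ℝ) : ℂ) * exp (((if q.2 then 1 else -1) * x q.1 : ℝ) * I) := by
  rw [Fintype.sum_prod_type]
  push_cast
  refine Finset.sum_congr rfl fun i _ => ?_
  rw [Fintype.sum_bool, Complex.cos]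
  simp
  ring

/-- Each cosine is half the sum of two exponentials, and a word p records one choice per factor. The
frequency depends only on the net letter counts, which become the integer coefficients in Effective
LI. -/
theorem sum_mul_cos_pow_eq {ι : Type*} [Fintype ι] [DecidableEq ι] (a x : ι → ℝ) (k : ℕ) :
    (((∑ i, a i * Real.cos (x i)) ^ k : ℝ) : ℂ) =
      ∑ p : Fin k → ι × Bool, ((∏ j, (a (p j).1 / 2) : ℝ) : ℂ) *
        exp ((∑ i, (signedCount p i : ℝ) * x i : ℝ) * I) := by
  rw [ofReal_pow, sum_mul_cos_eq, Fintype.sum_pow]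
  refine Finset.sum_congr rfl fun p _ => ?_
  rw [Finset.prod_mul_distrib, ← exp_sum, sum_signedCount_mul]
  push_cast
  rw [Finset.sum_mul]

/-- Total weight of the words: an error bound uniform over words gets multiplied by exactly this. -/
theorem sum_prod_half_eq {ι : Type*} [Fintype ι] (a : ι → ℝ) (k : ℕ) :
    ∑ p : Fin k → ι × Bool, ∏ j, (a (p j).1 / 2) = (∑ i, a i) ^ k := by
  rw [← Fintype.sum_pow (fun q : ι × Bool => a q.1 / 2), Fintype.sum_prod_type]
  congr 1
  refine Finset.sum_congr rfl fun i _ => ?_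
  rw [Fintype.sum_bool, add_halves]

theorem norm_integral_exp_mul_I_le {c d w φ : ℝ} (hw : w ≠ 0) :
    ‖∫ t in c..d, exp ((w * t + φ : ℝ) * I)‖ ≤ 2 / |w| := by
  have hw' : (w : ℂ) * I ≠ 0 := mul_ne_zero (ofReal_ne_zero.2 hw) I_ne_zero
  have e : ∀ t : ℝ, exp ((w * t + φ : ℝ) * I) = exp (φ * I) * exp ((w * I) * t) := fun t => by
    rw [← exp_add]; congr 1; push_cast; ring
  have hn : ∀ t : ℝ, ‖exp ((w * I) * t)‖ = 1 := fun t => by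
    rw [show (w : ℂ) * I * t = (w * t : ℝ) * I by push_cast; ring, norm_exp_ofReal_mul_I]
  simp_rw [e]
  rw [intervalIntegral.integral_const_mul, integral_exp_mul_complex hw', norm_mul,
    norm_exp_ofReal_mul_I, one_mul, norm_div, norm_mul, norm_I, mul_one, norm_real,
    Real.norm_eq_abs]
  gcongr
  refine (norm_sub_le _ _).trans ?_
  rw [hn, hn]
  norm_num

theorem integral_exp_int_mul_of_isUniform {Ω : Type*} [MeasurableSpace Ω] {μ : Measure Ω}
    {ϑ : Ω → ℝ} (hm : Measurable ϑ)
    (hu : pdf.IsUniform ϑ (Set.Icc (-Real.pi) Real.pi) μ volume) {n : ℤ} (hn : n ≠ 0) :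
    ∫ ω, exp (((n : ℝ) * ϑ ω : ℝ) * I) ∂μ = 0 := by
  have hmap : ∫ ω, exp (((n : ℝ) * ϑ ω : ℝ) * I) ∂μ =
      ∫ x, exp (((n : ℝ) * x : ℝ) * I) ∂(μ.map ϑ) := by
    rw [integral_map hm.aemeasurable]
    exact (by fun_prop : Continuous fun x : ℝ => exp (((n : ℝ) * x : ℝ) * I)).aestronglyMeasurable
  rw [hmap, hu, ProbabilityTheory.cond, integral_smul_measure, integral_Icc_eq_integral_Ioc,
    ← intervalIntegral.integral_of_le (by linarith [Real.pi_pos])]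
  have hc : (n : ℂ) * I ≠ 0 := mul_ne_zero (Int.cast_ne_zero.2 hn) I_ne_zero
  have e : ∀ t : ℝ, exp (((n : ℝ) * t : ℝ) * I) = exp ((n * I) * t) := fun t => by
    congr 1; push_cast; ring
  simp_rw [e]
  rw [integral_exp_mul_complex hc]
  have : exp ((n * I) * Real.pi) = exp ((n * I) * (-Real.pi : ℝ)) := by
    rw [exp_eq_exp_iff_exists_int]
    exact ⟨n, by push_cast; ring⟩
  rw [this, sub_self, zero_div, smul_zero]

/-- Independence factors the expectation, and a factor with nonzero coefficient integrates over full
periods to 0. -/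
theorem integral_exp_sum_int_mul {ι : Type*} [Fintype ι]
    {Ω : Type*} [MeasurableSpace Ω] {μ : Measure Ω}
    [IsProbabilityMeasure μ] {θ : ι → Ω → ℝ} (hθ : IsUniformIIDFamily μ θ) {l : ι → ℤ}
    (hl : l ≠ 0) :
    ∫ ω, exp ((∑ i, (l i : ℝ) * θ i ω : ℝ) * I) ∂μ = 0 := by
  obtain ⟨i, hi⟩ := Function.ne_iff.1 hl
  have e : ∀ ω, exp ((∑ i, (l i : ℝ) * θ i ω : ℝ) * I) =
      ∏ i, (fun (i : ι) (x : ℝ) => exp (((l i : ℝ) * x : ℝ) * I)) i (θ i ω) := fun ω => by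
    rw [← exp_sum]; push_cast; rw [Finset.sum_mul]
  simp_rw [e]
  rw [hθ.indep.integral_fun_prod_comp (fun i => (hθ.measurable i).aemeasurable)
    (fun i => (by fun_prop :
      Continuous fun x : ℝ => exp (((l i : ℝ) * x : ℝ) * I)).aestronglyMeasurable)]
  exact Finset.prod_eq_zero (Finset.mem_univ i)
    (integral_exp_int_mul_of_isUniform (hθ.measurable i) (hθ.uniform i) hi)

/-- The moments of a trigonometric polynomial on `[2, X]` agree with those of the random model, up
to an error controlled by the small integer linear combinations of its frequencies. -/
theorem abs_average_pow_sub_integral_pow_le {ι : Type*} [Fintype ι]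
    {Ω : Type*} [MeasurableSpace Ω] {μ : Measure Ω}
    [IsProbabilityMeasure μ] {θ : ι → Ω → ℝ} (hθ : IsUniformIIDFamily μ θ)
    {a β g : ι → ℝ} (ha : ∀ i, 0 ≤ a i) {k : ℕ} {δ X : ℝ} (hδ : 0 < δ) (hX : 2 ≤ X)
    (hsep : ∀ l : ι → ℤ, (∀ i, |l i| ≤ k) → l ≠ 0 → δ ≤ |∑ i, (l i : ℝ) * g i|) :
    |(1 / X) * (∫ t in (2 : ℝ)..X, (∑ i, a i * Real.cos (g i * t + β i)) ^ k) -
        ∫ ω, (∑ i, a i * Real.cos (θ i ω)) ^ k ∂μ| ≤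
      2 / X * (1 + 1 / δ) * (∑ i, a i) ^ k := by
  classical
  have hX0 : 0 < X := by linarith
  set w : (Fin k → ι × Bool) → ℝ := fun p => ∏ j, (a (p j).1 / 2)
  have hw : ∀ p, 0 ≤ w p := fun p => Finset.prod_nonneg fun j _ => by have := ha (p j).1; positivity
  have hT : (((∫ t in (2 : ℝ)..X, (∑ i, a i * Real.cos (g i * t + β i)) ^ k) : ℝ) : ℂ) =
      ∑ p, (w p : ℂ) * ∫ t in (2 : ℝ)..X,
        exp (((∑ i, (signedCount p i : ℝ) * g i) * t +
          ∑ i, (signedCount p i : ℝ) * β i : ℝ) * I) := by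
    rw [← intervalIntegral.integral_ofReal]
    simp_rw [sum_mul_cos_pow_eq]
    rw [intervalIntegral.integral_finsetSum fun p _ =>
      Continuous.intervalIntegrable (by fun_prop) _ _]
    refine Finset.sum_congr rfl fun p _ => ?_
    rw [intervalIntegral.integral_const_mul]
    congr 1
    refine intervalIntegral.integral_congr fun t _ => ?_
    simp only [Finset.sum_mul, ← Finset.sum_add_distrib]
    congr 3
    refine Finset.sum_congr rfl fun i _ => ?_
    ring
  have hΩ : (((∫ ω, (∑ i, a i * Real.cos (θ i ω)) ^ k ∂μ) : ℝ) : ℂ) =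
      ∑ p, (w p : ℂ) * ∫ ω, exp ((∑ i, (signedCount p i : ℝ) * θ i ω : ℝ) * I) ∂μ := by
    rw [← integral_complex_ofReal]
    have := hθ.measurable
    simp_rw [sum_mul_cos_pow_eq]
    rw [integral_finsetSum]
    · simp_rw [integral_const_mul]
      rfl
    · intro p _
      refine Integrable.const_mul (Integrable.of_bound (by fun_prop) 1
        (.of_forall fun ω => (norm_exp_ofReal_mul_I _).le)) _
  rw [← Real.norm_eq_abs, ← norm_real]
  push_cast
  rw [hT, hΩ, Finset.mul_sum, ← Finset.sum_sub_distrib, ← sum_prod_half_eq, Finset.mul_sum]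
  refine (norm_sum_le _ _).trans (Finset.sum_le_sum fun p _ => ?_)
  rw [mul_left_comm, ← mul_sub, norm_mul, norm_real, Real.norm_of_nonneg (hw p), mul_comm]
  refine mul_le_mul_of_nonneg_right ?_ (hw p)
  -- A balanced word differs from the model by 2/X only because the average starts at 2. For any
  -- other word the model gives 0 and the oscillating integral at most 2/δ.
  by_cases hp : signedCount p = 0
  · simp only [hp, Pi.zero_apply, Int.cast_zero, zero_mul, Finset.sum_const_zero, add_zero,
      ofReal_zero, exp_zero, intervalIntegral.integral_const, integral_const, probReal_univ,
      real_smul, mul_one, one_smul]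
    have : (1 / X : ℂ) * ((X - 2 : ℝ) : ℂ) - 1 = ((-(2 / X) : ℝ) : ℂ) := by
      have : (X : ℂ) ≠ 0 := ofReal_ne_zero.2 hX0.ne'
      push_cast
      field_simp
      ring
    push_cast at this ⊢
    rw [this, norm_neg, norm_div, norm_real, Real.norm_of_nonneg hX0.le]
    norm_num
    have : 0 ≤ 2 / X * δ⁻¹ := by positivity
    linarith
  · have h := hsep _ (abs_signedCount_le p) hp
    have hne : ∑ i, (signedCount p i : ℝ) * g i ≠ 0 := fun h0 => by
      rw [h0, abs_zero] at h; linarith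
    rw [integral_exp_sum_int_mul hθ hp, sub_zero, norm_mul, norm_div, norm_one, norm_real,
      Real.norm_of_nonneg hX0.le]
    calc _ ≤ 1 / X * (2 / |∑ i, (signedCount p i : ℝ) * g i|) := by
          gcongr; exact norm_integral_exp_mul_I_le hne
      _ ≤ 1 / X * (2 / δ) := by gcongr
      _ = 2 / X * (0 + 1 / δ) := by ring
      _ ≤ _ := by gcongr; norm_num

end Moments

/-! ### From moments to exponential moments by a truncated Taylor series. -/

section ExponentialMoments

theorem abs_sum_mul_cos_le {κ : Type*} (S : Finset κ) {a : κ → ℝ} (ha : ∀ i, 0 ≤ a i)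
    (x : κ → ℝ) : |∑ i ∈ S, a i * Real.cos (x i)| ≤ ∑ i ∈ S, a i := by
  refine (Finset.abs_sum_le_sum_abs _ _).trans (Finset.sum_le_sum fun i _ => ?_)
  rw [abs_mul, abs_of_nonneg (ha i)]
  exact mul_le_of_le_one_right (ha i) (Real.abs_cos_le_one _)

/-- Rankin's trick: inserting e^{k-K} ≥ 1 in the terms k ≥ K bounds the tail by e^{-K} times the
full series for e^{eY}. -/
theorem abs_exp_sub_sum_range_le {y Y : ℝ} (hy : |y| ≤ Y) (K : ℕ) :
    |Real.exp y - ∑ k ∈ Finset.range K, y ^ k / k.factorial| ≤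
      Real.exp (-K) * Real.exp (Real.exp 1 * Y) := by
  have hs : ∀ x : ℝ, HasSum (fun k : ℕ => x ^ k / k.factorial) (Real.exp x) := fun x => by
    rw [Real.exp_eq_exp_ℝ]
    exact NormedSpace.expSeries_div_hasSum_exp x
  have hY : 0 ≤ Y := (abs_nonneg y).trans hy
  have he := hs (Real.exp 1 * Y)
  have htail := (hasSum_nat_add_iff' K).2 (hs y)
  have hetail := (hasSum_nat_add_iff' K).2 he
  rw [← htail.tsum_eq, ← Real.norm_eq_abs]
  refine (tsum_of_norm_bounded (hetail.mul_left (Real.exp (-K))) fun k => ?_).trans ?_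
  · rw [norm_div, norm_pow, Real.norm_eq_abs, Real.norm_natCast, mul_pow, ← Real.exp_nat_mul,
      mul_one, mul_div_assoc, ← mul_assoc, ← Real.exp_add]
    push_cast
    rw [neg_add_eq_sub, add_sub_cancel_right]
    calc |y| ^ (k + K) / ((k + K).factorial : ℝ) ≤ 1 * (Y ^ (k + K) / (k + K).factorial) := by
          rw [one_mul]; gcongr
      _ ≤ _ := by
          gcongr
          exact Real.one_le_exp k.cast_nonneg
  · gcongr
    have : 0 ≤ ∑ k ∈ Finset.range K, (Real.exp 1 * Y) ^ k / (k.factorial : ℝ) :=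
      Finset.sum_nonneg fun k _ => by positivity
    linarith

/-- Exponential moments of a trigonometric polynomial on `[2, X]` agree with those of the random
model. -/
theorem abs_average_exp_sub_integral_exp_le {ι : Type*} [Fintype ι]
    {Ω : Type*} [MeasurableSpace Ω] {μ : Measure Ω}
    [IsProbabilityMeasure μ] {θ : ι → Ω → ℝ} (hθ : IsUniformIIDFamily μ θ)
    {a β g : ι → ℝ} (ha : ∀ i, 0 ≤ a i) {K : ℕ} {δ X s : ℝ} (hδ : 0 < δ) (hX : 2 ≤ X)
    (hsep : ∀ l : ι → ℤ, (∀ i, |l i| ≤ K) → l ≠ 0 → δ ≤ |∑ i, (l i : ℝ) * g i|) :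
    |(1 / X) * (∫ t in (2 : ℝ)..X, Real.exp (s * ∑ i, a i * Real.cos (g i * t + β i))) -
        ∫ ω, Real.exp (s * ∑ i, a i * Real.cos (θ i ω)) ∂μ| ≤
      2 / X * (1 + 1 / δ) * Real.exp (|s| * ∑ i, a i) +
        2 * (Real.exp (-K) * Real.exp (Real.exp 1 * (|s| * ∑ i, a i))) := by
  have hX0 : 0 < X := by linarith
  have hm := hθ.measurable
  set Y := |s| * ∑ i, a i
  set τ := Real.exp (-K) * Real.exp (Real.exp 1 * Y)
  set F : ℝ → ℝ := fun t => ∑ i, a i * Real.cos (g i * t + β i)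
  set G : Ω → ℝ := fun ω => ∑ i, a i * Real.cos (θ i ω)
  set P : ℝ → ℝ := fun y => ∑ k ∈ Finset.range K, (s * y) ^ k / k.factorial
  have hbound : ∀ x : ι → ℝ, |∑ i, a i * Real.cos (x i)| ≤ ∑ i, a i :=
    abs_sum_mul_cos_le Finset.univ ha
  have hsb : ∀ y, |y| ≤ ∑ i, a i → |s * y| ≤ Y := fun y hy => by
    rw [abs_mul]; exact mul_le_mul_of_nonneg_left hy (abs_nonneg s)
  have htail : ∀ y, |y| ≤ ∑ i, a i → |Real.exp (s * y) - P y| ≤ τ := fun y hy =>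
    abs_exp_sub_sum_range_le (hsb y hy) K
  have hFc : Continuous F := by fun_prop
  have hGm : Measurable G := by fun_prop
  have hGint : ∀ k : ℕ, Integrable (fun ω => G ω ^ k) μ := fun k =>
    Integrable.of_bound (by fun_prop) ((∑ i, a i) ^ k) (.of_forall fun ω => by
      rw [norm_pow, Real.norm_eq_abs]
      exact pow_le_pow_left₀ (abs_nonneg _) (hbound fun i => θ i ω) k)
  have hPk : ∀ y, P y = ∑ k ∈ Finset.range K, (s ^ k / k.factorial) * y ^ k := fun y =>
    Finset.sum_congr rfl fun k _ => by rw [mul_pow]; ring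
  have hPF : ∫ t in (2 : ℝ)..X, P (F t) =
      ∑ k ∈ Finset.range K, (s ^ k / k.factorial) * ∫ t in (2 : ℝ)..X, F t ^ k := by
    simp_rw [hPk]
    rw [intervalIntegral.integral_finsetSum fun k _ =>
      Continuous.intervalIntegrable (by fun_prop) _ _]
    simp_rw [intervalIntegral.integral_const_mul]
  have hPG : ∫ ω, P (G ω) ∂μ = ∑ k ∈ Finset.range K, (s ^ k / k.factorial) * ∫ ω, G ω ^ k ∂μ := by
    simp_rw [hPk]
    rw [integral_finsetSum _ fun k _ => (hGint k).const_mul _]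
    simp_rw [integral_const_mul]
  have hPGi : Integrable (fun ω => P (G ω)) μ := by
    simp_rw [hPk]
    exact integrable_finsetSum _ fun k _ => (hGint k).const_mul _
  have hEGi : Integrable (fun ω => Real.exp (s * G ω)) μ :=
    Integrable.of_bound (by fun_prop) (Real.exp Y) (.of_forall fun ω => by
      rw [Real.norm_of_nonneg (Real.exp_pos _).le]
      exact Real.exp_le_exp.2 ((le_abs_self _).trans (hsb _ (hbound fun i => θ i ω))))
  have e1 : |(1 / X) * ((∫ t in (2 : ℝ)..X, Real.exp (s * F t)) - ∫ t in (2 : ℝ)..X, P (F t))|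
      ≤ τ := by
    rw [← intervalIntegral.integral_sub (Continuous.intervalIntegrable (by fun_prop) _ _)
      (Continuous.intervalIntegrable (by fun_prop) _ _), abs_mul, abs_of_pos (by positivity)]
    have h := intervalIntegral.norm_integral_le_of_norm_le_const (a := 2) (b := X) (C := τ)
      (f := fun t => Real.exp (s * F t) - P (F t)) fun t _ => htail _ (hbound _)
    rw [Real.norm_eq_abs, abs_of_nonneg (by linarith : 0 ≤ X - 2)] at h
    have hτ : 0 ≤ τ := by positivity
    rw [div_mul_eq_mul_div, one_mul, div_le_iff₀ hX0]
    nlinarith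
  have e2 : |∫ ω, P (G ω) ∂μ - ∫ ω, Real.exp (s * G ω) ∂μ| ≤ τ := by
    rw [← integral_sub hPGi hEGi, ← Real.norm_eq_abs]
    refine (norm_integral_le_of_norm_le_const (C := τ) (.of_forall fun ω => ?_)).trans_eq (by simp)
    rw [norm_sub_rev]
    exact htail _ (hbound _)
  have e3 : |(1 / X) * (∫ t in (2 : ℝ)..X, P (F t)) - ∫ ω, P (G ω) ∂μ| ≤
      2 / X * (1 + 1 / δ) * Real.exp Y := by
    rw [hPF, hPG, Finset.mul_sum, ← Finset.sum_sub_distrib]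
    refine (Finset.abs_sum_le_sum_abs _ _).trans ?_
    have hterm : ∀ k ∈ Finset.range K,
        |1 / X * (s ^ k / k.factorial * ∫ t in (2 : ℝ)..X, F t ^ k) -
          s ^ k / k.factorial * ∫ ω, G ω ^ k ∂μ| ≤
        2 / X * (1 + 1 / δ) * (Y ^ k / k.factorial) := fun k hk => by
      have h := abs_average_pow_sub_integral_pow_le hθ (β := β) ha (k := k) hδ hX fun l hl =>
        hsep l fun i => (hl i).trans (by exact_mod_cast (Finset.mem_range.1 hk).le)
      rw [mul_left_comm, ← mul_sub, abs_mul, abs_div, abs_pow, Nat.abs_cast]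
      calc _ ≤ |s| ^ k / k.factorial * (2 / X * (1 + 1 / δ) * (∑ i, a i) ^ k) := by gcongr
        _ = _ := by rw [mul_pow]; ring
    refine (Finset.sum_le_sum hterm).trans ?_
    rw [← Finset.mul_sum]
    gcongr
    exact Real.sum_le_exp_of_nonneg
      (mul_nonneg (abs_nonneg s) (Finset.sum_nonneg fun i _ => ha i)) K
  have split : (1 / X) * (∫ t in (2 : ℝ)..X, Real.exp (s * F t)) - ∫ ω, Real.exp (s * G ω) ∂μ =
      (1 / X) * ((∫ t in (2 : ℝ)..X, Real.exp (s * F t)) - ∫ t in (2 : ℝ)..X, P (F t)) +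
      ((1 / X) * (∫ t in (2 : ℝ)..X, P (F t)) - ∫ ω, P (G ω) ∂μ) +
      (∫ ω, P (G ω) ∂μ - ∫ ω, Real.exp (s * G ω) ∂μ) := by ring
  rw [split]
  refine (abs_add_three _ _ _).trans ?_
  linarith

end ExponentialMoments

/-! ### Choice of parameters under Effective LI. -/

section ExponentialMomentsOfZeroSum

open Topology

theorem ordinatesUpTo_mono {T T' : ℝ} (h : T ≤ T') : ordinatesUpTo T ⊆ ordinatesUpTo T' := by
  intro γ hγ
  rw [ordinatesUpTo, Set.Finite.mem_toFinset] at hγ ⊢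
  exact le_trans hγ h

theorem zeroCount_mono {T T' : ℝ} (h : T ≤ T') : zeroCount T ≤ zeroCount T' := by
  refine Finset.sum_le_sum_of_subset fun ρ hρ => ?_
  rw [Set.Finite.mem_toFinset] at hρ ⊢
  exact ⟨hρ.1, hρ.2.1, hρ.2.2.trans h⟩

theorem zeroSum_eq_sum_subtype (r : zetaOrdinates → ℂ) (t T : ℝ) :
    zeroSum r t T = ∑ γ : ordinatesUpTo T,
      ‖r γ‖ * Real.cos (((γ : zetaOrdinates) : ℝ) * t + (r γ).arg) := by
  rw [zeroSum, Finset.sum_coe_sort (ordinatesUpTo T)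
    (fun γ => ‖r γ‖ * Real.cos ((γ : ℝ) * t + (r γ).arg))]
  exact Finset.sum_congr rfl fun γ _ => mul_comm _ _

/-- The conjectural lower bound at height `T'`, for combinations of the ordinates up to `T ≤ T'`. -/
theorem EffectiveLI.exists_le_abs_sum (h : EffectiveLI) {η : ℝ} (hη : 0 < η) :
    ∃ C : ℝ, 0 < C ∧ ∀ T T' : ℝ, 2 ≤ T' → T ≤ T' → ∀ K : ℕ, K ≤ zeroCount T' →
      ∀ l : ordinatesUpTo T → ℤ, (∀ γ, |l γ| ≤ K) → l ≠ 0 →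
        C * Real.exp (-(T' ^ (1 + η))) ≤ |∑ γ, (l γ : ℝ) * ((γ : zetaOrdinates) : ℝ)| := by
  classical
  obtain ⟨C, hC, hli⟩ := h η hη
  refine ⟨C, hC, fun T T' hT' hTT' K hK l hl hl0 => ?_⟩
  -- Extension by zero lets the coefficients be as large as N(T') instead of N(T).
  set L : zetaOrdinates → ℤ := fun γ => if hγ : γ ∈ ordinatesUpTo T then l ⟨γ, hγ⟩ else 0
  have hLl : ∀ γ : ordinatesUpTo T, L γ = l γ := fun γ => by simp [L]
  obtain ⟨γ₀, hγ₀⟩ := Function.ne_iff.1 hl0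
  have key := hli T' hT' L (fun γ _ => ?_)
    ⟨γ₀, ordinatesUpTo_mono hTT' γ₀.2, by rw [hLl]; exact hγ₀⟩
  · refine key.trans_eq ?_
    congr 1
    rw [← Finset.sum_subset (ordinatesUpTo_mono hTT') fun γ _ hγ => by simp [L, hγ],
      ← Finset.sum_coe_sort]
    exact Finset.sum_congr rfl fun γ _ => by rw [hLl]
  · by_cases hγ : γ ∈ ordinatesUpTo T
    · simp only [L, hγ, dite_true]
      exact (hl _).trans (by exact_mod_cast hK)
    · simp [L, hγ]

theorem IsUniformIIDFamily.comp_injective {ι κ Ω : Type*} [MeasurableSpace Ω] {μ : Measure Ω}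
    {θ : ι → Ω → ℝ} (h : IsUniformIIDFamily μ θ) {e : κ → ι} (he : Function.Injective e) :
    IsUniformIIDFamily μ fun j => θ (e j) :=
  ⟨fun _ => h.measurable _, h.indep.precomp he, fun _ => h.uniform _⟩

theorem abs_average_exp_zeroSum_sub_integral_le_two_mul_exp (r : zetaOrdinates → ℂ)
    {Ω : Type*} [MeasurableSpace Ω] (μ : Measure Ω) [IsProbabilityMeasure μ]
    (θ : zetaOrdinates → Ω → ℝ) {X : ℝ} (hX : 2 ≤ X) (T s : ℝ) :
    |(1 / X) * (∫ t in (2 : ℝ)..X, Real.exp (s * zeroSum r t T)) -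
        ∫ ω, Real.exp (s * ∑ γ ∈ ordinatesUpTo T, ‖r γ‖ * Real.cos (θ γ ω)) ∂μ| ≤
      2 * Real.exp (|s| * ∑ γ ∈ ordinatesUpTo T, ‖r γ‖) := by
  set Y := |s| * ∑ γ ∈ ordinatesUpTo T, ‖r γ‖
  have hX0 : 0 < X := by linarith
  have hb : ∀ x : zetaOrdinates → ℝ,
      ‖Real.exp (s * ∑ γ ∈ ordinatesUpTo T, ‖r γ‖ * Real.cos (x γ))‖ ≤ Real.exp Y := fun x => by
    rw [Real.norm_of_nonneg (Real.exp_pos _).le, Real.exp_le_exp]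
    refine (le_abs_self _).trans ?_
    rw [abs_mul]
    exact mul_le_mul_of_nonneg_left (abs_sum_mul_cos_le _ (fun _ => norm_nonneg _) _)
      (abs_nonneg s)
  have h1 : |(1 / X) * (∫ t in (2 : ℝ)..X, Real.exp (s * zeroSum r t T))| ≤ Real.exp Y := by
    have h := intervalIntegral.norm_integral_le_of_norm_le_const (a := 2) (b := X)
      (C := Real.exp Y) (f := fun t => Real.exp (s * zeroSum r t T)) fun t _ => by
        simp only [zeroSum, mul_comm (Real.cos _)]
        exact hb fun γ => (γ : ℝ) * t + (r γ).arg
    rw [Real.norm_eq_abs, abs_of_nonneg (by linarith : 0 ≤ X - 2)] at h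
    rw [abs_mul, abs_of_pos (by positivity), div_mul_eq_mul_div, one_mul, div_le_iff₀ hX0]
    nlinarith [Real.exp_pos Y]
  have h2 : |∫ ω, Real.exp (s * ∑ γ ∈ ordinatesUpTo T, ‖r γ‖ * Real.cos (θ γ ω)) ∂μ| ≤
      Real.exp Y := by
    rw [← Real.norm_eq_abs]
    exact (norm_integral_le_of_norm_le_const (.of_forall fun ω => hb fun γ => θ γ ω)).trans_eq
      (by simp)
  refine (abs_sub _ _).trans ?_
  linarith

/-- The first inequality keeps the truncation order, whose ceiling costs the 1, below N(T^{1+η}).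
The second lets X absorb the loss from Effective LI together with e^{Y + N(T)}. -/
theorem exists_mul_log_le_rpow (D : ℝ) {η ε : ℝ} (hη : 0 < η) (hηε : (1 + η) * (1 + η) < 1 + ε) :
    ∃ T₀ : ℝ, ∀ T : ℝ, T₀ ≤ T → D * (T * Real.log T) + 1 ≤ T ^ (1 + η) / 8 ∧
      D * (T * Real.log T) + T ^ ((1 + η) * (1 + η)) ≤ T ^ (1 + ε) := by
  have hlog : ∀ᶠ T : ℝ in atTop, |Real.log T| ≤ 1 / (16 * (|D| + 1)) * |T ^ η| :=
    (isLittleO_log_rpow_atTop hη).bound (by positivity)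
  have hone : ∀ᶠ T : ℝ in atTop, (16 : ℝ) ≤ T ^ (1 + η) :=
    (tendsto_rpow_atTop (by linarith)).eventually_ge_atTop 16
  have htwo : ∀ᶠ T : ℝ in atTop, (2 : ℝ) ≤ T ^ (1 + ε - (1 + η) * (1 + η)) :=
    (tendsto_rpow_atTop (by linarith)).eventually_ge_atTop 2
  obtain ⟨T₀, hT₀⟩ := eventually_atTop.1
    (hlog.and (hone.and (htwo.and (eventually_ge_atTop (1 : ℝ)))))
  refine ⟨T₀, fun T hT => ?_⟩
  obtain ⟨h1, h2, h3, h4⟩ := hT₀ T hT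
  have hT0 : 0 < T := by linarith
  have hpow : T ^ (1 + η) = T * T ^ η := by rw [Real.rpow_add hT0, Real.rpow_one]
  have hDlog : D * (T * Real.log T) ≤ T ^ (1 + η) / 16 := by
    rw [abs_of_pos (Real.rpow_pos_of_pos hT0 η)] at h1
    have hD : 0 < |D| + 1 := by positivity
    calc D * (T * Real.log T) ≤ (|D| + 1) * (T * |Real.log T|) := by
          refine (le_abs_self _).trans ?_
          rw [abs_mul, abs_mul, abs_of_pos hT0]
          gcongr
          linarith
      _ ≤ (|D| + 1) * (T * (1 / (16 * (|D| + 1)) * T ^ η)) := by gcongr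
      _ = T ^ (1 + η) / 16 := by rw [hpow]; field_simp
  refine ⟨by linarith, ?_⟩
  have hmono : T ^ (1 + η) ≤ T ^ ((1 + η) * (1 + η)) :=
    Real.rpow_le_rpow_of_exponent_le h4 (by nlinarith)
  have hsplit : T ^ (1 + ε) = T ^ ((1 + η) * (1 + η)) * T ^ (1 + ε - (1 + η) * (1 + η)) := by
    rw [← Real.rpow_add hT0]; ring_nf
  have hpos : 0 < T ^ ((1 + η) * (1 + η)) := Real.rpow_pos_of_pos hT0 _
  have hpos' : 0 < T ^ (1 + η) := Real.rpow_pos_of_pos hT0 _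
  rw [hsplit]
  nlinarith

theorem exists_zeroCount_le_mul_log :
    ∃ K : ℝ, 0 < K ∧ ∀ T : ℝ, 4 ≤ T → (zeroCount T : ℝ) ≤ K * (T * Real.log T) := by
  obtain ⟨K, hK, h⟩ := exists_zeroCount_le
  refine ⟨4 * K, by positivity, fun T hT => (h T (by linarith)).trans ?_⟩
  have hlog : Real.log (T + 9) ≤ 2 * Real.log T := by
    rw [← Real.log_rpow (by linarith)]
    exact Real.log_le_log (by linarith) (by rw [Real.rpow_two]; nlinarith)
  have hlT : 0 < Real.log T := Real.log_pos (by linarith)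
  have hlT9 : 0 ≤ Real.log (T + 9) := Real.log_nonneg (by linarith)
  calc K * ((T + 1) * Real.log (T + 9)) ≤ K * ((2 * T) * (2 * Real.log T)) := by
        gcongr; linarith
    _ = 4 * K * (T * Real.log T) := by ring

theorem rpow_one_add_le_log {X T ε : ℝ} (hX : 1 ≤ Real.log X) (hT : 2 ≤ T) (hε : 0 < ε)
    (hTX : T ≤ Real.log X ^ (1 - ε)) : T ^ (1 + ε) ≤ Real.log X := by
  have h0 : 0 ≤ Real.log X := by linarith
  calc T ^ (1 + ε) ≤ (Real.log X ^ (1 - ε)) ^ (1 + ε) := by gcongr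
    _ = Real.log X ^ ((1 - ε) * (1 + ε)) := by rw [← Real.rpow_mul h0]
    _ ≤ Real.log X ^ (1 : ℝ) := Real.rpow_le_rpow_of_exponent_le hX (by nlinarith)
    _ = Real.log X := Real.rpow_one _

/-- The main estimate for `T` beyond some height depending only on `r`, `A` and `ε`. -/
theorem exists_abs_average_exp_zeroSum_sub_integral_le_of_large (hELI : EffectiveLI)
    (r : zetaOrdinates → ℂ) (A : ℝ) (hr : Assumption1 r A) (ε : ℝ) (hε : 0 < ε) :
    ∃ T₀ C : ℝ, 2 ≤ T₀ ∧ 0 < C ∧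
      ∀ (Ω : Type*) [MeasurableSpace Ω] (μ : Measure Ω) [IsProbabilityMeasure μ]
        (θ : zetaOrdinates → Ω → ℝ), IsUniformIIDFamily μ θ →
      ∀ X T s : ℝ, 3 ≤ X → T₀ ≤ T → T ≤ Real.log X ^ (1 - ε) →
        |s| ≤ T * Real.log T ^ (1 - A) →
        |(1 / X) * (∫ t in (2 : ℝ)..X, Real.exp (s * zeroSum r t T)) -
            ∫ ω, Real.exp (s * ∑ γ ∈ ordinatesUpTo T, ‖r γ‖ * Real.cos (θ γ ω)) ∂μ| ≤
          C * Real.exp (-(zeroCount T : ℝ)) := by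
  -- With η ≤ 1, (1+η)² ≤ 1 + 3η ≤ 1 + 3ε/4.
  set η : ℝ := min (ε / 4) 1
  have hη : 0 < η := lt_min (by positivity) one_pos
  have hηε : (1 + η) * (1 + η) < 1 + ε := by
    have h1 : η ≤ ε / 4 := min_le_left _ _
    have h2 : η ≤ 1 := min_le_right _ _
    nlinarith
  obtain ⟨c, hc, hli⟩ := hELI.exists_le_abs_sum hη
  obtain ⟨B, hB, hH⟩ := hr.2.1.exists_pos
  obtain ⟨T₁, hT₁⟩ := eventually_atTop.1 hH.bound
  obtain ⟨K, hK, hN⟩ := exists_zeroCount_le_mul_log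
  obtain ⟨T₂, hT₂⟩ := exists_le_zeroCount
  obtain ⟨T₃, hT₃⟩ := exists_mul_log_le_rpow (K + 3 * B) hη hηε
  refine ⟨max 4 (max T₁ (max T₂ T₃)), 2 * (1 + 1 / c) + 2,
    by linarith [le_max_left 4 (max T₁ (max T₂ T₃))], by positivity, ?_⟩
  intro Ω _ μ _ θ hθ X T s hX hT hTX hs
  simp only [max_le_iff] at hT
  obtain ⟨h4, h1, h2, h3⟩ := hT
  have hT0 : 0 < T := by linarith
  have hX0 : 0 < X := by linarith
  have hlT : 0 < Real.log T := Real.log_pos (by linarith)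
  have hlX : 1 ≤ Real.log X := by
    rw [Real.le_log_iff_exp_le hX0]
    linarith [Real.exp_one_lt_d9]
  have hYle : |s| * ∑ γ : ordinatesUpTo T, ‖r γ‖ ≤ B * (T * Real.log T) := by
    have hHT := hT₁ T h1
    rw [Real.norm_of_nonneg (Finset.sum_nonneg fun _ _ => norm_nonneg _),
      Real.norm_of_nonneg (Real.rpow_nonneg hlT.le _)] at hHT
    rw [Finset.sum_coe_sort (ordinatesUpTo T) fun γ => ‖r γ‖]
    calc _ ≤ (T * Real.log T ^ (1 - A)) * (B * Real.log T ^ A) := by gcongr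
      _ = B * (T * (Real.log T ^ (1 - A) * Real.log T ^ A)) := by ring
      _ = B * (T * Real.log T) := by
        rw [← Real.rpow_add hlT, sub_add_cancel, Real.rpow_one]
  set Y := |s| * ∑ γ : ordinatesUpTo T, ‖r γ‖
  have hY0 : 0 ≤ Y := mul_nonneg (abs_nonneg s) (Finset.sum_nonneg fun _ _ => norm_nonneg _)
  obtain ⟨hd1, hd2⟩ := hT₃ T h3
  have hNT := hN T h4
  set T' := T ^ (1 + η)
  have hTT' : T ≤ T' := Real.self_le_rpow_of_one_le (by linarith) (by linarith)
  -- As e < 3, this makes the Taylor tail e^{-k} e^{eY} at most e^{-N(T)}.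
  set k : ℕ := zeroCount T + ⌈3 * Y⌉₊
  have hk1 : (zeroCount T : ℝ) + 3 * Y ≤ k := by
    simp only [k]; push_cast
    linarith [Nat.le_ceil (3 * Y)]
  have hk2 : k ≤ zeroCount T' := by
    have hc1 := (Nat.ceil_lt_add_one (by positivity : 0 ≤ 3 * Y)).le
    have : (k : ℝ) ≤ zeroCount T' := by
      refine le_trans ?_ (hT₂ T' (h2.trans hTT'))
      simp only [k]; push_cast
      linarith
    exact_mod_cast this
  have hmain := abs_average_exp_sub_integral_exp_le
    (hθ.comp_injective (Subtype.val_injective (p := (· ∈ ordinatesUpTo T))))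
    (a := fun γ => ‖r γ‖) (β := fun γ => (r γ).arg)
    (g := fun γ : ordinatesUpTo T => ((γ : zetaOrdinates) : ℝ)) (fun _ => norm_nonneg _) (K := k)
    (δ := c * Real.exp (-(T' ^ (1 + η)))) (X := X) (s := s) (by positivity) (by linarith)
    (hli T T' (by linarith) hTT' k hk2)
  simp_rw [zeroSum_eq_sum_subtype]
  have hsumθ : ∀ ω, ∑ γ ∈ ordinatesUpTo T, ‖r γ‖ * Real.cos (θ γ ω) =
      ∑ γ : ordinatesUpTo T, ‖r γ‖ * Real.cos (θ γ ω) := fun ω =>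
    (Finset.sum_coe_sort (ordinatesUpTo T) fun γ => ‖r γ‖ * Real.cos (θ γ ω)).symm
  simp_rw [hsumθ]
  refine hmain.trans ?_
  rw [add_mul]
  refine add_le_add ?_ ?_
  · have hT'pow : T' ^ (1 + η) = T ^ ((1 + η) * (1 + η)) := (Real.rpow_mul hT0.le _ _).symm
    have hδ : 1 + 1 / (c * Real.exp (-(T' ^ (1 + η)))) ≤
        (1 + 1 / c) * Real.exp (T ^ ((1 + η) * (1 + η))) := by
      have h1E : 1 ≤ Real.exp (T ^ ((1 + η) * (1 + η))) := Real.one_le_exp (by positivity)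
      rw [hT'pow, Real.exp_neg, one_div, mul_inv, inv_inv, one_div]
      linarith
    have hXexp : 2 / X = 2 * Real.exp (-Real.log X) := by
      rw [Real.exp_neg, Real.exp_log hX0, div_eq_mul_inv]
    have hlogX := rpow_one_add_le_log hlX (by linarith) hε hTX
    calc 2 / X * (1 + 1 / (c * Real.exp (-(T' ^ (1 + η))))) * Real.exp Y
        ≤ 2 * Real.exp (-Real.log X) * ((1 + 1 / c) * Real.exp (T ^ ((1 + η) * (1 + η)))) *
            Real.exp Y := by rw [hXexp]; gcongr
      _ = 2 * (1 + 1 / c) * Real.exp (-Real.log X + T ^ ((1 + η) * (1 + η)) + Y) := by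
          rw [Real.exp_add, Real.exp_add]; ring
      _ ≤ 2 * (1 + 1 / c) * Real.exp (-(zeroCount T : ℝ)) := by
          gcongr
          linarith
  · rw [← Real.exp_add]
    gcongr
    nlinarith [Real.exp_one_lt_d9]

end ExponentialMomentsOfZeroSum

theorem mainTheorem5 (hELI : EffectiveLI) (r : zetaOrdinates → ℂ) (A : ℝ)
    (hr : Assumption1 r A) (ε : ℝ) (hε : 0 < ε) :
    ∃ c₀ C X₀ : ℝ, 0 < c₀ ∧ 0 < C ∧
      ∀ (Ω : Type*) [MeasurableSpace Ω] (μ : Measure Ω) [IsProbabilityMeasure μ]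
        (θ : zetaOrdinates → Ω → ℝ), IsUniformIIDFamily μ θ →
      ∀ X T s : ℝ, X₀ ≤ X → 2 ≤ T → T ≤ Real.log X ^ (1 - ε) →
        |s| ≤ c₀ * T * Real.log T ^ (1 - A) →
        |(1 / X) * (∫ t in (2 : ℝ)..X, Real.exp (s * zeroSum r t T)) -
            ∫ ω, Real.exp (s * ∑ γ ∈ ordinatesUpTo T, ‖r γ‖ * Real.cos (θ γ ω)) ∂μ| ≤
          C * Real.exp (-(zeroCount T : ℝ)) := by
  obtain ⟨T₀, C, hT₀, hC, hlarge⟩ :=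
    exists_abs_average_exp_zeroSum_sub_integral_le_of_large hELI r A hr ε hε
  -- For T in the compact range [2, T₀], s and the coefficient sum are bounded, and a factor
  -- e^{N(T₀)} in the constant pays for e^{-N(T)}.
  have hcont : ContinuousOn (fun T : ℝ => T * Real.log T ^ (1 - A)) (Set.Icc 2 T₀) := fun T hT =>
    (continuousAt_id.mul ((Real.continuousAt_log (by linarith [hT.1])).rpow_const
      (.inl (Real.log_pos (by linarith [hT.1])).ne'))).continuousWithinAt
  obtain ⟨S, hS⟩ := isCompact_Icc.exists_bound_of_continuousOn hcont
  set H := ∑ γ ∈ ordinatesUpTo T₀, ‖r γ‖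
  set C₁ := 2 * Real.exp (S * H) * Real.exp (zeroCount T₀)
  -- X ≥ 3 > e gives log X ≥ 1, as needed to pass from T ≤ (log X)^{1-ε} to T^{1+ε} ≤ log X.
  refine ⟨1, max C C₁, 3, one_pos, lt_max_of_lt_left hC, ?_⟩
  intro Ω _ μ _ θ hθ X T s hX hT hTX hs
  rw [one_mul] at hs
  rcases le_total T₀ T with h | h
  · refine (hlarge Ω μ θ hθ X T s hX h hTX hs).trans ?_
    gcongr
    exact le_max_left _ _
  · refine (abs_average_exp_zeroSum_sub_integral_le_two_mul_exp r μ θ (by linarith) T s).trans ?_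
    have hsS : |s| ≤ S := hs.trans ((le_abs_self _).trans (hS T ⟨hT, h⟩))
    have hHH : ∑ γ ∈ ordinatesUpTo T, ‖r γ‖ ≤ H :=
      Finset.sum_le_sum_of_subset_of_nonneg (ordinatesUpTo_mono h) fun _ _ _ => norm_nonneg _
    have hS0 : 0 ≤ S := (abs_nonneg s).trans hsS
    have hNN : (zeroCount T : ℝ) ≤ zeroCount T₀ := by exact_mod_cast zeroCount_mono h
    calc 2 * Real.exp (|s| * ∑ γ ∈ ordinatesUpTo T, ‖r γ‖) ≤ 2 * Real.exp (S * H) := by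
          gcongr
      _ = C₁ * Real.exp (-(zeroCount T₀ : ℝ)) := by
          rw [mul_assoc, ← Real.exp_add, add_neg_cancel, Real.exp_zero, mul_one]
      _ ≤ max C C₁ * Real.exp (-(zeroCount T : ℝ)) := by
          gcongr
          exact le_max_right _ _
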